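/- Let $f:[-\pi,\pi]\to\mathbb R$ be Lebesgue integrable with $\int_{-\pi}^{\pi}f(\theta)\,d\theta=0$. Put $\alpha_k=\frac1\pi\int_{-\pi}^{\pi}\cos(k\theta)f(\theta)\,d\theta$, $\beta_k=\frac1\pi\int_{-\pi}^{\pi}\sin(k\theta)f(\theta)\,d\theta$, $c_0=\alpha_0/2=0$, $c_k=\alpha_k-i\beta_k$ for $k\ge1$, and $w(z)=\sum_{k=0}^{\infty}c_kz^k$ for $|z|<1$. Let $g:[-\pi,\pi]\to\mathbb R$ be the Fourier-conjugate function of $f$, that is, $g(\theta)=\lim_{\rho\to1^-}\operatorname{Im}w(\rho e^{i\theta})$ for almost every $\theta$, and suppose that $g$ is Lebesgue integrable. Then for almost every $\theta\in[-\pi,\pi]$ the following two identities hold for every integer $k\ge1$, where $\Delta\theta=\theta_1-\theta$ and the principal values exist: $$f(\theta)=\frac1{2\pi}\,\mathrm{PV}\!\!\int_{-\pi}^{\pi}\frac{\sin[(k+\frac12)\Delta\theta]\,f(\theta_1)+\cos[(k+\frac12)\Delta\theta]\,g(\theta_1)}{\sin(\Delta\theta/2)}\,d\theta_1,$$ $$g(\theta)=\frac1{2\pi}\,\mathrm{PV}\!\!\int_{-\pi}^{\pi}\frac{\sin[(k+\frac12)\Delta\theta]\,g(\theta_1)-\cos[(k+\frac12)\Delta\theta]\,f(\theta_1)}{\sin(\Delta\theta/2)}\,d\theta_1.$$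 Here $\mathrm{PV}\!\int_{-\pi}^{\pi}h(\theta_1)\,d\theta_1$ is the Cauchy principal value at $\theta_1=\theta$, i.e. the limit as $\varepsilon\to0^+$ of the Lebesgue integral of $h$ over $\{\theta_1\in[-\pi,\pi]:|\theta_1-\theta|>\varepsilon\}$. -/

import Mathlib

open MeasureTheory Filter Topology

noncomputable section

/-- The Fourier cosine coefficient `α_k` of a real function on `[-π, π]`. -/
def cosCoeff (f : ℝ → ℝ) (k : ℕ) : ℝ :=
  (1 / Real.pi) * ∫ θ in (-Real.pi)..Real.pi, Real.cos (k * θ) * f θ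

/-- The Fourier sine coefficient `β_k` of a real function on `[-π, π]`. -/
def sinCoeff (f : ℝ → ℝ) (k : ℕ) : ℝ :=
  (1 / Real.pi) * ∫ θ in (-Real.pi)..Real.pi, Real.sin (k * θ) * f θ

/-- The Taylor coefficients `c_0 = α_0 / 2` and `c_k = α_k - i β_k` for `k ≥ 1`. -/
def taylorCoeff (f : ℝ → ℝ) (k : ℕ) : ℂ :=
  if k = 0 then ((cosCoeff f 0 / 2 : ℝ) : ℂ)
  else (cosCoeff f k : ℂ) - Complex.I * (sinCoeff f k : ℂ)

/-- The inner analytic function `w(z) = ∑ c_k z^k` of `f`, for `|z| < 1`. -/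
def innerAnalytic (f : ℝ → ℝ) (z : ℂ) : ℂ :=
  ∑' k : ℕ, taylorCoeff f k * z ^ k

/-- `g` is Fourier-conjugate to `f` on `[-π, π]`: almost everywhere `g(θ)` is the limit, as
`ρ → 1` from below, of the imaginary part of `w(ρ e^{iθ})`. -/
def IsFourierConjugate (f g : ℝ → ℝ) : Prop :=
  ∀ᵐ θ : ℝ ∂(volume.restrict (Set.Icc (-Real.pi) Real.pi)),
    Tendsto (fun ρ : ℝ => (innerAnalytic f ((ρ : ℂ) * Complex.exp (Complex.I * (θ : ℂ)))).im)
      (𝓝[<] 1) (𝓝 (g θ))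

/-- The Cauchy principal value at `θ` of the integral of `h` over `[-π, π]` exists and equals `I`:
`h` is integrable off every neighbourhood of `θ`, and the integrals of `h` over
`{θ₁ ∈ [-π, π] : |θ₁ - θ| > ε}` tend to `I` as `ε → 0+`. -/
def HasPrincipalValue (h : ℝ → ℝ) (θ I : ℝ) : Prop :=
  (∀ ε : ℝ, 0 < ε →
    IntegrableOn h {θ₁ | θ₁ ∈ Set.Icc (-Real.pi) Real.pi ∧ ε < |θ₁ - θ|} volume) ∧
  Tendsto (fun ε : ℝ =>
      ∫ θ₁ in {θ₁ | θ₁ ∈ Set.Icc (-Real.pi) Real.pi ∧ ε < |θ₁ - θ|}, h θ₁)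
    (𝓝[>] 0) (𝓝 I)

end

/-! Put `Φ = f + i g`. Both identities are parts of one complex statement: the principal value of `∫
e^{i(k+1/2)s} / sin (s/2) * Φ(t) dt`, with `s = t - θ`, equals `2πi Φ(θ)`. Its imaginary part gives
the formula for `f`, and minus its real part the formula for `g`.

Two facts carry the proof. The first is that `Φ` is annihilated by every `e^{ikt}` with `k ≥ 1`. As
`Φ` is the radial limit of `w`, this is a Cauchy theorem on the boundary, but `w` is not known in
advance to be in the Hardy class `H¹`. Writing `f` as the difference of its positive and negative
parts makes `w` a difference of two analytic functions with nonnegative real part. Integrability of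
`Φ` then suffices (Smirnov, `integral_exp_mul_radialLimit_eq_zero`). The real part of `w` has radial
limit `f` by Fatou's theorem (`tendsto_re_innerAnalytic`); the imaginary part has limit `g` by
hypothesis.

The second fact is that, with `z = e^{is}`, the kernel for `k = 0` is `-2iz/(1 - z)`, the boundary
value of `-2iz/(1 - ρz)`. The latter is a power series in positive powers of `z`, so its integral
against `Φ` is zero. With `1 - ρ = ε`, the kernel truncated at `ε` minus this series has size `min
(1/ε) (ε/s²)`, so its integral against `Φ - Φ(θ)` tends to zero at every Lebesgue point
(`tendsto_integral_kernel_mul`). The constant `Φ(θ)` is integrated exactly. Passing from `k = 0` to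
general `k` adds only positive frequencies, which `Φ` annihilates. -/

/-- Lebesgue measure on `[-π, π]`. -/
noncomputable abbrev arcMeasure : Measure ℝ := volume.restrict (Set.Icc (-Real.pi) Real.pi)

theorem intervalIntegral_eq_integral_arcMeasure {E : Type*} [NormedAddCommGroup E]
    [NormedSpace ℝ E] (h : ℝ → E) :
    ∫ θ in (-Real.pi)..Real.pi, h θ = ∫ θ, h θ ∂arcMeasure := by
  rw [intervalIntegral.integral_of_le (by linarith [Real.pi_pos]),
    ← integral_Icc_eq_integral_Ioc]

theorem arcMeasure_real_univ : arcMeasure.real Set.univ = 2 * Real.pi := by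
  have := Real.pi_pos
  simp only [arcMeasure, measureReal_restrict_apply_univ, Real.volume_real_Icc]
  rw [max_eq_left (by linarith)]
  ring

/-! ### The inner function as a Herglotz integral -/

theorem hasSum_of_eq {u v : ℕ → ℂ} {a b : ℂ} (h : HasSum v b) (huv : ∀ k, u k = v k)
    (hab : a = b) : HasSum u a := by
  rw [hab, funext huv]
  exact h

/-- Termwise integration of the geometric series, dominated by `‖a‖ ^ j * ∫ ‖Φ‖`. It serves twice:
to sum the Taylor series of `w` (with `ζ = e^{-it}`), and to turn vanishing Fourier coefficients
into vanishing of a kernel integral (with `ζ = e^{i(t-θ)}`). -/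
theorem hasSum_integral_geometric {α : Type*} [MeasurableSpace α] {μ : Measure α} {Φ ζ : α → ℂ}
    (hΦ : Integrable Φ μ) (hζ : Measurable ζ) (hζ1 : ∀ t, ‖ζ t‖ ≤ 1) {a : ℂ} (ha : ‖a‖ < 1) :
    HasSum (fun j : ℕ => a ^ j * ∫ t, ζ t ^ j * Φ t ∂μ) (∫ t, Φ t / (1 - a * ζ t) ∂μ) := by
  have hbd : ∀ (j : ℕ) t, ‖ζ t ^ j‖ ≤ 1 := fun j t => by
    rw [norm_pow]; exact pow_le_one₀ (norm_nonneg _) (hζ1 t)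
  have hint : ∀ j : ℕ, Integrable (fun t => a ^ j * (ζ t ^ j * Φ t)) μ := fun j =>
    (hΦ.bdd_mul (hζ.pow_const j).aestronglyMeasurable
      (Eventually.of_forall fun t => hbd j t)).const_mul _
  have hsum : Summable fun j : ℕ => ∫ t, ‖a ^ j * (ζ t ^ j * Φ t)‖ ∂μ := by
    refine Summable.of_nonneg_of_le (fun j => integral_nonneg fun t => norm_nonneg _) (fun j => ?_)
      ((summable_geometric_of_lt_one (norm_nonneg a) ha).mul_right (∫ t, ‖Φ t‖ ∂μ))
    rw [← integral_const_mul]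
    refine integral_mono (hint j).norm (hΦ.norm.const_mul _) fun t => ?_
    simp only [norm_mul, norm_pow]
    refine mul_le_mul_of_nonneg_left ?_ (by positivity)
    have := hbd j t
    rw [norm_pow] at this
    exact mul_le_of_le_one_left (norm_nonneg _) this
  have h := hasSum_integral_of_summable_integral_norm hint hsum
  simp only [integral_const_mul] at h
  refine hasSum_of_eq h (fun _ => rfl) ?_
  refine integral_congr_ae (Eventually.of_forall fun t => ?_)
  have h1 : ‖a * ζ t‖ < 1 := by
    rw [norm_mul]
    exact (mul_le_of_le_one_right (norm_nonneg _) (hζ1 t)).trans_lt ha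
  have h2 := (hasSum_geometric_of_norm_lt_one h1).mul_right (Φ t)
  simp only [mul_pow, mul_assoc] at h2
  simp only
  rw [h2.tsum_eq, div_eq_mul_inv, mul_comm]

theorem norm_exp_I_mul (t : ℝ) : ‖Complex.exp (Complex.I * t)‖ = 1 := by
  rw [mul_comm]; exact Complex.norm_exp_ofReal_mul_I t

theorem norm_exp_neg_I_mul (t : ℝ) : ‖Complex.exp (-(Complex.I * t))‖ = 1 := by
  rw [Complex.exp_neg, norm_inv, norm_exp_I_mul, inv_one]

theorem integral_exp_I_mul_pow {n : ℕ} (hn : n ≠ 0) :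
    ∫ t : ℝ, Complex.exp (Complex.I * t) ^ n ∂arcMeasure = 0 := by
  rw [← intervalIntegral_eq_integral_arcMeasure]
  have hn' : (n : ℂ) * Complex.I ≠ 0 := by simp [hn]
  have : ∀ t : ℝ, Complex.exp (Complex.I * t) ^ n = Complex.exp (n * Complex.I * t) := fun t => by
    rw [← Complex.exp_nat_mul]; ring_nf
  simp only [this]
  rw [integral_exp_mul_complex hn', div_eq_zero_iff]
  left
  rw [sub_eq_zero, Complex.exp_eq_exp_iff_exists_int]
  exact ⟨n, by push_cast; ring⟩

theorem integrable_ofReal {f : ℝ → ℝ} (hf : Integrable f arcMeasure) :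
    Integrable (fun t => (f t : ℂ)) arcMeasure := hf.ofReal

theorem cosCoeff_sub_I_mul_sinCoeff {f : ℝ → ℝ} (hf : Integrable f arcMeasure) (k : ℕ) :
    (cosCoeff f k : ℂ) - Complex.I * (sinCoeff f k : ℂ) =
      1 / Real.pi * ∫ t : ℝ, Complex.exp (-(Complex.I * t)) ^ k * f t ∂arcMeasure := by
  have hc : Integrable (fun t => Real.cos (k * t) * f t) arcMeasure :=
    hf.bdd_mul (c := 1) (by fun_prop) (Eventually.of_forall fun t => Real.abs_cos_le_one _)
  have hs : Integrable (fun t => Real.sin (k * t) * f t) arcMeasure :=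
    hf.bdd_mul (c := 1) (by fun_prop) (Eventually.of_forall fun t => Real.abs_sin_le_one _)
  simp only [cosCoeff, sinCoeff, intervalIntegral_eq_integral_arcMeasure]
  push_cast
  rw [← integral_complex_ofReal, ← integral_complex_ofReal, ← mul_assoc, mul_comm Complex.I, mul_assoc, ← mul_sub,
    ← integral_const_mul, ← integral_sub hc.ofReal (hs.ofReal.const_mul _)]
  congr 1
  refine integral_congr_ae (Eventually.of_forall fun t => ?_)
  have : Complex.exp (-(Complex.I * t)) ^ k =
      Complex.cos (k * t) - Complex.I * Complex.sin (k * t) := by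
    rw [← Complex.exp_nat_mul]
    have := Complex.exp_mul_I (-((k : ℂ) * t))
    rw [Complex.cos_neg, Complex.sin_neg] at this
    rw [show (k : ℂ) * -(Complex.I * t) = -(k * t) * Complex.I by ring, this]
    ring
  simp only [this]
  simp
  ring

theorem innerAnalytic_hasSum {f : ℝ → ℝ} (hf : Integrable f arcMeasure) {z : ℂ} (hz : ‖z‖ < 1) :
    HasSum (fun k : ℕ => taylorCoeff f k * z ^ k)
      (1 / (2 * Real.pi) * ∫ t : ℝ, (2 / (1 - z * Complex.exp (-(Complex.I * t))) - 1) * f t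
        ∂arcMeasure) := by
  have hpi : (Real.pi : ℂ) ≠ 0 := by exact_mod_cast Real.pi_ne_zero
  have h := hasSum_integral_geometric (ζ := fun t : ℝ => Complex.exp (-(Complex.I * t)))
    (integrable_ofReal hf) (by fun_prop) (fun t => (norm_exp_neg_I_mul t).le) hz
  -- The geometric series yields `c_k` for `k ≥ 1` but `α_0` at `k = 0`; half of it is subtracted
  -- because `c_0 = α_0 / 2`. This produces the `- 1` in the Herglotz kernel.
  have h1 := (h.mul_left (1 / Real.pi : ℂ)).sub
    (hasSum_ite_eq (0 : ℕ) (1 / (2 * Real.pi) * ∫ t : ℝ, (f t : ℂ) ∂arcMeasure))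
  refine hasSum_of_eq h1 (fun k => ?_) ?_
  · by_cases hk : k = 0
    · subst hk
      have := cosCoeff_sub_I_mul_sinCoeff hf 0
      have h0 : sinCoeff f 0 = 0 := by simp [sinCoeff]
      rw [h0] at this
      simp only [pow_zero, one_mul, Complex.ofReal_zero, mul_zero, sub_zero] at this
      simp only [taylorCoeff, if_true, pow_zero, one_mul, mul_one]
      push_cast
      rw [this]
      field_simp
      ring
    · simp only [taylorCoeff, if_neg hk, cosCoeff_sub_I_mul_sinCoeff hf k]
      simp; ring
  · have hi : Integrable (fun t : ℝ => (f t : ℂ) / (1 - z * Complex.exp (-(Complex.I * t))))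
        arcMeasure := by
      simp only [div_eq_inv_mul]
      refine (integrable_ofReal hf).bdd_mul (c := (1 - ‖z‖)⁻¹) (Measurable.aestronglyMeasurable (by fun_prop))
        (Eventually.of_forall fun t => ?_)
      rw [norm_inv]
      refine inv_anti₀ (by linarith) ?_
      have := norm_sub_norm_le 1 (z * Complex.exp (-(Complex.I * t)))
      rwa [norm_mul, norm_exp_neg_I_mul, mul_one, norm_one] at this
    have : ∀ t : ℝ, (2 / (1 - z * Complex.exp (-(Complex.I * t))) - 1) * (f t : ℂ) =
        2 * ((f t : ℂ) / (1 - z * Complex.exp (-(Complex.I * t)))) - f t := fun t => by ring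
    simp only [this]
    rw [integral_sub (hi.const_mul 2) (integrable_ofReal hf), integral_const_mul]
    field_simp

theorem innerAnalytic_eq {f : ℝ → ℝ} (hf : Integrable f arcMeasure) {z : ℂ} (hz : ‖z‖ < 1) :
    innerAnalytic f z =
      1 / (2 * Real.pi) * ∫ t : ℝ, (2 / (1 - z * Complex.exp (-(Complex.I * t))) - 1) * f t
        ∂arcMeasure :=
  (innerAnalytic_hasSum hf hz).tsum_eq

theorem norm_herglotz_le {z : ℂ} (hz : ‖z‖ < 1) (t : ℝ) :
    ‖2 / (1 - z * Complex.exp (-(Complex.I * t))) - 1‖ ≤ 2 / (1 - ‖z‖) + 1 := by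
  refine (norm_sub_le _ _).trans ?_
  rw [norm_div, norm_one, Complex.norm_ofNat]
  have := norm_sub_norm_le 1 (z * Complex.exp (-(Complex.I * t)))
  rw [norm_mul, norm_exp_neg_I_mul, mul_one, norm_one] at this
  have h0 : 0 < 1 - ‖z‖ := by linarith
  gcongr

theorem integrable_herglotz_mul {f : ℝ → ℝ} (hf : Integrable f arcMeasure) {z : ℂ} (hz : ‖z‖ < 1) :
    Integrable (fun t : ℝ => (2 / (1 - z * Complex.exp (-(Complex.I * t))) - 1) * (f t : ℂ))
      arcMeasure :=
  (integrable_ofReal hf).bdd_mul (Measurable.aestronglyMeasurable (by fun_prop))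
    (Eventually.of_forall fun t => norm_herglotz_le hz t)

theorem innerAnalytic_sub {p q : ℝ → ℝ} (hp : Integrable p arcMeasure)
    (hq : Integrable q arcMeasure) {z : ℂ} (hz : ‖z‖ < 1) :
    innerAnalytic (fun t => p t - q t) z = innerAnalytic p z - innerAnalytic q z := by
  rw [innerAnalytic_eq hp hz, innerAnalytic_eq hq hz, innerAnalytic_eq (f := fun t => p t - q t) (hp.sub hq) hz, ← mul_sub,
    ← integral_sub (integrable_herglotz_mul hp hz) (integrable_herglotz_mul hq hz)]
  simp [mul_sub]

/-- Lets `f θ` be subtracted from `f` inside the Poisson integral, so no separate normalization of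
the kernel is needed. -/
theorem innerAnalytic_const (c : ℝ) (z : ℂ) :
    innerAnalytic (fun _ => c) z = c := by
  have hc : Integrable (fun _ : ℝ => c) arcMeasure := integrable_const _
  have hpi : (Real.pi : ℂ) ≠ 0 := by exact_mod_cast Real.pi_ne_zero
  have hT : ∀ k, taylorCoeff (fun _ => c) k = if k = 0 then (c : ℂ) else 0 := by
    intro k
    by_cases hk : k = 0
    · subst hk
      simp only [taylorCoeff, cosCoeff, if_true]
      simp
      field_simp
      ring
    · simp only [taylorCoeff, if_neg hk, cosCoeff_sub_I_mul_sinCoeff hc]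
      have h := integral_exp_I_mul_pow hk
      have h2 : ∫ t : ℝ, Complex.exp (-(Complex.I * t)) ^ k ∂arcMeasure = 0 := by
        have := congrArg (starRingEnd ℂ) h
        rw [← integral_conj] at this
        simpa [← Complex.exp_conj] using this
      rw [integral_mul_const, h2]
      simp
  rw [innerAnalytic, tsum_eq_single 0]
  · simp [hT]
  · intro k hk
    simp [hT, hk]

/-- The real part of the Herglotz kernel is the Poisson kernel; its positivity gives
`re_innerAnalytic_nonneg`. -/
theorem re_two_div_one_sub_sub_one {u : ℂ} (hu : ‖u‖ < 1) :
    (2 / (1 - u) - 1).re = (1 - ‖u‖ ^ 2) / ‖1 - u‖ ^ 2 := by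
  have h0 : 1 - u ≠ 0 := fun h => by
    rw [sub_eq_zero] at h
    rw [← h] at hu
    simp at hu
  have h1 : ‖1 - u‖ ^ 2 ≠ 0 := by simpa using h0
  rw [Complex.sub_re, Complex.div_re]
  rw [← Complex.normSq_eq_norm_sq, ← Complex.normSq_eq_norm_sq] at *
  field_simp
  simp [Complex.normSq_apply]
  ring

theorem re_innerAnalytic {f : ℝ → ℝ} (hf : Integrable f arcMeasure) {z : ℂ} (hz : ‖z‖ < 1) :
    (innerAnalytic f z).re =
      1 / (2 * Real.pi) * ∫ t : ℝ, (1 - ‖z‖ ^ 2) /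
        ‖1 - z * Complex.exp (-(Complex.I * t))‖ ^ 2 * f t ∂arcMeasure := by
  rw [innerAnalytic_eq hf hz]
  rw [show (1 / (2 * Real.pi) : ℂ) = ((1 / (2 * Real.pi) : ℝ) : ℂ) by push_cast; rfl,
    Complex.re_ofReal_mul]
  congr 1
  rw [← RCLike.re_eq_complex_re, ← integral_re (integrable_herglotz_mul hf hz)]
  refine integral_congr_ae (Eventually.of_forall fun t => ?_)
  have hu : ‖z * Complex.exp (-(Complex.I * t))‖ = ‖z‖ := by
    rw [norm_mul, norm_exp_neg_I_mul, mul_one]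
  simp only [RCLike.re_eq_complex_re, Complex.re_mul_ofReal]
  rw [re_two_div_one_sub_sub_one (hu.trans_lt hz), hu]

theorem re_innerAnalytic_nonneg {f : ℝ → ℝ} (hf : Integrable f arcMeasure) (h0 : ∀ t, 0 ≤ f t)
    {z : ℂ} (hz : ‖z‖ < 1) : 0 ≤ (innerAnalytic f z).re := by
  rw [re_innerAnalytic hf hz]
  have := Real.pi_pos
  refine mul_nonneg (by positivity) (integral_nonneg fun t => mul_nonneg (div_nonneg ?_ ?_) (h0 t))
  · nlinarith [norm_nonneg z]
  · positivity

theorem norm_taylorCoeff_le {f : ℝ → ℝ} (hf : Integrable f arcMeasure) :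
    ∃ C, ∀ k, ‖taylorCoeff f k‖ ≤ C := by
  refine ⟨‖taylorCoeff f 0‖ + 1 / Real.pi * ∫ t, ‖f t‖ ∂arcMeasure, fun k => ?_⟩
  have hpi := Real.pi_pos
  have h0 : 0 ≤ ∫ t, ‖f t‖ ∂arcMeasure := integral_nonneg fun t => norm_nonneg _
  by_cases hk : k = 0
  · subst hk
    have : 0 ≤ 1 / Real.pi * ∫ t, ‖f t‖ ∂arcMeasure := by positivity
    linarith
  · simp only [taylorCoeff, if_neg hk, cosCoeff_sub_I_mul_sinCoeff hf]
    refine le_add_of_nonneg_of_le (norm_nonneg _) ?_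
    rw [norm_mul]
    have : ‖(1 / Real.pi : ℂ)‖ = 1 / Real.pi := by
      rw [norm_div, Complex.norm_real, norm_one, Real.norm_of_nonneg hpi.le]
    rw [this]
    refine mul_le_mul_of_nonneg_left ((norm_integral_le_integral_norm _).trans_eq ?_) (by positivity)
    refine integral_congr_ae (Eventually.of_forall fun t => ?_)
    simp [norm_exp_neg_I_mul]

theorem differentiableOn_innerAnalytic {f : ℝ → ℝ} (hf : Integrable f arcMeasure) :
    DifferentiableOn ℂ (innerAnalytic f) (Metric.ball 0 1) := by
  obtain ⟨C, hC⟩ := norm_taylorCoeff_le hf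
  intro z hz
  have hz1 : ‖z‖ < 1 := by simpa using hz
  obtain ⟨r, hzr, hr1⟩ := exists_between hz1
  have hr0 : 0 ≤ r := (norm_nonneg z).trans hzr.le
  have hd : DifferentiableOn ℂ (innerAnalytic f) (Metric.ball 0 r) := by
    refine Complex.differentiableOn_tsum_of_summable_norm
      (u := fun k => C * r ^ k) ((summable_geometric_of_lt_one hr0 hr1).mul_left C)
      (fun k => by fun_prop) Metric.isOpen_ball (fun k w hw => ?_)
    rw [norm_mul, norm_pow]
    have hw1 : ‖w‖ ≤ r := by
      have : ‖w‖ < r := by simpa using hw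
      exact this.le
    exact mul_le_mul (hC k) (pow_le_pow_left₀ (norm_nonneg _) hw1 k) (by positivity)
      ((norm_nonneg _).trans (hC k))
  exact (hd.differentiableAt (Metric.isOpen_ball.mem_nhds (by simpa using hzr))).differentiableWithinAt

/-! ### Lebesgue points and approximate identities -/

/-- `x` is a Lebesgue point of `Φ` as a function on `[-π, π]`. -/
def IsLebesguePoint (Φ : ℝ → ℂ) (x : ℝ) : Prop :=
  Tendsto (fun r : ℝ => r⁻¹ * ∫ t in Metric.closedBall x r, ‖Φ t - Φ x‖ ∂arcMeasure) (𝓝[>] 0) (𝓝 0)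

theorem ae_isLebesguePoint {Φ : ℝ → ℂ} (hΦ : Integrable Φ arcMeasure) :
    ∀ᵐ x ∂arcMeasure, IsLebesguePoint Φ x := by
  set A := Set.Icc (-Real.pi) Real.pi with hA
  have hloc : Integrable (A.indicator Φ) volume := (integrable_indicator_iff measurableSet_Icc).2 hΦ
  have h := IsUnifLocDoublingMeasure.ae_tendsto_average_norm_sub volume
    hloc.locallyIntegrable 1
  rw [ae_restrict_iff' measurableSet_Icc]
  filter_upwards [h] with x hx hxA
  -- The average over a ball divides by its length `2 * r`, whereas `IsLebesguePoint` divides by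
  -- `r`; hence the factor 2.
  have h1 := (hx (fun _ => x) (fun r : ℝ => r) (l := 𝓝[>] (0 : ℝ)) tendsto_id ?_).const_mul 2
  · rw [mul_zero] at h1
    refine squeeze_zero' ?_ ?_ h1
    · filter_upwards [self_mem_nhdsWithin] with r hr
      have : (0 : ℝ) < r := hr
      exact mul_nonneg (by positivity) (integral_nonneg fun t => norm_nonneg _)
    · filter_upwards [self_mem_nhdsWithin] with r hr
      have hr0 : (0 : ℝ) < r := hr
      rw [setAverage_eq, smul_eq_mul, Real.volume_real_closedBall hr0.le, Set.indicator_of_mem hxA]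
      have : ∫ t in Metric.closedBall x r, ‖Φ t - Φ x‖ ∂arcMeasure ≤
          ∫ t in Metric.closedBall x r, ‖A.indicator Φ t - Φ x‖ := by
        rw [arcMeasure, Measure.restrict_restrict measurableSet_closedBall]
        have he : ∫ t in Metric.closedBall x r ∩ A, ‖Φ t - Φ x‖ =
            ∫ t in Metric.closedBall x r ∩ A, ‖A.indicator Φ t - Φ x‖ :=
          setIntegral_congr_fun (measurableSet_closedBall.inter measurableSet_Icc)
            fun t ht => by simp only [Set.indicator_of_mem ht.2]
        rw [he]
        refine setIntegral_mono_set ?_ (Eventually.of_forall fun t => norm_nonneg _)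
          (Set.inter_subset_left).eventuallyLE
        exact (hloc.integrableOn.sub (integrableOn_const
          (measure_closedBall_lt_top.ne))).norm
      calc r⁻¹ * ∫ t in Metric.closedBall x r, ‖Φ t - Φ x‖ ∂arcMeasure
          ≤ r⁻¹ * ∫ t in Metric.closedBall x r, ‖A.indicator Φ t - Φ x‖ := by gcongr
        _ = _ := by field_simp
  · filter_upwards [self_mem_nhdsWithin] with r hr
    have : (0 : ℝ) < r := hr
    simp [this.le]

/-- On the annulus `2^(j-1) ε < |t - x| ≤ 2^j ε` the second bound gives `‖M t‖ ≤ 4C / (4^j ε)`; on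
the central ball the first bound does. One factor `2^{-j}` normalizes the integral over the ball of
radius `2^j ε`, and the other makes the sum converge. -/
theorem norm_integral_mul_le_tsum_dyadic {μ : Measure ℝ} {Ψ M : ℝ → ℂ} (hΨ : Integrable Ψ μ)
    {x C ε : ℝ} (hε : 0 < ε) (hC : 0 ≤ C)
    (h1 : ∀ᵐ t ∂μ, ‖M t‖ ≤ C / ε) (h2 : ∀ᵐ t ∂μ, ‖M t‖ * (t - x) ^ 2 ≤ C * ε)
    (hs : Summable fun j : ℕ => 4 * C * (1 / 2) ^ j *
      ((2 ^ j * ε)⁻¹ * ∫ t in Metric.closedBall x (2 ^ j * ε), ‖Ψ t‖ ∂μ)) :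
    ‖∫ t, M t * Ψ t ∂μ‖ ≤ ∑' j : ℕ, 4 * C * (1 / 2) ^ j *
      ((2 ^ j * ε)⁻¹ * ∫ t in Metric.closedBall x (2 ^ j * ε), ‖Ψ t‖ ∂μ) := by
  have hnn : ∀ j : ℕ, 0 ≤ 4 * C * (1 / 2) ^ j *
      ((2 ^ j * ε)⁻¹ * ∫ t in Metric.closedBall x (2 ^ j * ε), ‖Ψ t‖ ∂μ) := fun j =>
    mul_nonneg (by positivity) (mul_nonneg (by positivity) (integral_nonneg fun t => norm_nonneg _))
  have key : ‖∫ t, M t * Ψ t ∂μ‖ₑ ≤ ENNReal.ofReal (∑' j : ℕ, 4 * C * (1 / 2) ^ j *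
      ((2 ^ j * ε)⁻¹ * ∫ t in Metric.closedBall x (2 ^ j * ε), ‖Ψ t‖ ∂μ)) := by
    rw [ENNReal.ofReal_tsum_of_nonneg hnn hs]
    have hterm : ∀ j : ℕ, ENNReal.ofReal (4 * C * (1 / 2) ^ j *
        ((2 ^ j * ε)⁻¹ * ∫ t in Metric.closedBall x (2 ^ j * ε), ‖Ψ t‖ ∂μ)) =
        ∫⁻ t, ENNReal.ofReal (4 * C / (4 ^ j * ε)) *
          (Metric.closedBall x (2 ^ j * ε)).indicator (fun t => ‖Ψ t‖ₑ) t ∂μ := fun j => by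
      rw [lintegral_const_mul' _ _ ENNReal.ofReal_ne_top,
        lintegral_indicator measurableSet_closedBall,
        ← ofReal_integral_norm_eq_lintegral_enorm hΨ.integrableOn,
        ← ENNReal.ofReal_mul (by positivity)]
      congr 1
      have : (4 : ℝ) ^ j = 2 ^ j * 2 ^ j := by rw [← mul_pow]; norm_num
      rw [this, one_div, inv_pow]
      field_simp
    simp only [hterm]
    rw [← lintegral_tsum fun j =>
      (hΨ.1.enorm.indicator measurableSet_closedBall).const_mul _]
    refine (enorm_integral_le_lintegral_enorm _).trans (lintegral_mono_ae ?_)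
    filter_upwards [h1, h2] with t ht1 ht2
    have hex : ∃ j : ℕ, |t - x| ≤ 2 ^ j * ε := by
      obtain ⟨j, hj⟩ := pow_unbounded_of_one_lt (|t - x| / ε) (one_lt_two)
      exact ⟨j, ((div_lt_iff₀ hε).1 hj).le⟩
    classical
    obtain ⟨j, hj, hmin⟩ : ∃ j : ℕ, |t - x| ≤ 2 ^ j * ε ∧ ∀ i < j, 2 ^ i * ε < |t - x| :=
      ⟨Nat.find hex, Nat.find_spec hex, fun i hi => not_le.1 (Nat.find_min hex hi)⟩
    refine le_trans ?_ (ENNReal.le_tsum j)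
    rw [Set.indicator_of_mem (by rwa [Metric.mem_closedBall, Real.dist_eq]), enorm_mul]
    gcongr
    rw [← ofReal_norm]
    refine ENNReal.ofReal_le_ofReal ?_
    rcases j with _ | i
    · refine ht1.trans ?_
      rw [pow_zero, one_mul]
      gcongr
      linarith
    · have hi := hmin i (Nat.lt_succ_self i)
      have hp : 0 < 2 ^ i * ε := by positivity
      have hsq : (2 ^ i * ε) ^ 2 ≤ (t - x) ^ 2 := by
        rw [← sq_abs (t - x)]; gcongr
      have h3 : ‖M t‖ * (2 ^ i * ε) ^ 2 ≤ C * ε :=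
        (mul_le_mul_of_nonneg_left hsq (norm_nonneg _)).trans ht2
      rw [le_div_iff₀ (by positivity)]
      have : (4 : ℝ) ^ (i + 1) = 4 * (2 ^ i * 2 ^ i) := by
        rw [← mul_pow, pow_succ]; norm_num; ring
      rw [this]
      have h4 : ‖M t‖ * (4 * (2 ^ i * 2 ^ i) * ε) * ε ≤ 4 * C * ε := by nlinarith
      exact le_of_mul_le_mul_right h4 hε
  rw [← ofReal_norm] at key
  exact (ENNReal.ofReal_le_ofReal_iff (tsum_nonneg hnn)).1 key

/-- Convergence at a Lebesgue point for kernels of size `min (1 / ε) (ε / (t - x) ^ 2)`. -/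
theorem tendsto_integral_kernel_mul {μ : Measure ℝ} {Ψ : ℝ → ℂ} (hΨ : Integrable Ψ μ) {x C : ℝ}
    (hL : Tendsto (fun r : ℝ => r⁻¹ * ∫ t in Metric.closedBall x r, ‖Ψ t‖ ∂μ) (𝓝[>] 0) (𝓝 0))
    {M : ℝ → ℝ → ℂ} (hC : 0 ≤ C)
    (h1 : ∀ᶠ ε in 𝓝[>] 0, ∀ᵐ t ∂μ, ‖M ε t‖ ≤ C / ε)
    (h2 : ∀ᶠ ε in 𝓝[>] 0, ∀ᵐ t ∂μ, ‖M ε t‖ * (t - x) ^ 2 ≤ C * ε) :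
    Tendsto (fun ε => ∫ t, M ε t * Ψ t ∂μ) (𝓝[>] 0) (𝓝 0) := by
  set G : ℝ → ℝ := fun r => r⁻¹ * ∫ t in Metric.closedBall x r, ‖Ψ t‖ ∂μ with hG
  have hG0 : ∀ r, 0 < r → 0 ≤ G r := fun r hr =>
    mul_nonneg (by positivity) (integral_nonneg fun t => norm_nonneg _)
  -- The normalized integrals are below 1 for small radii by the Lebesgue condition and at most `δ⁻¹
  -- ∫ ‖Ψ‖` for the others. This uniform bound lets the dyadic sum pass to the limit term by term.
  obtain ⟨K, hK⟩ : ∃ K, ∀ r, 0 < r → G r ≤ K := by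
    have h3 := hL.eventually (gt_mem_nhds zero_lt_one)
    obtain ⟨δ, hδ, hδ1⟩ := mem_nhdsGT_iff_exists_Ioo_subset.1 h3
    have hδ0 : (0 : ℝ) < δ := hδ
    have hn : 0 ≤ ∫ t, ‖Ψ t‖ ∂μ := integral_nonneg fun t => norm_nonneg _
    refine ⟨1 + δ⁻¹ * ∫ t, ‖Ψ t‖ ∂μ, fun r hr => ?_⟩
    rcases lt_or_ge r δ with h | h
    · have : G r < 1 := hδ1 ⟨hr, h⟩
      have : 0 ≤ δ⁻¹ * ∫ t, ‖Ψ t‖ ∂μ := by positivity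
      linarith
    · have : G r ≤ δ⁻¹ * ∫ t, ‖Ψ t‖ ∂μ := by
        refine mul_le_mul (inv_anti₀ hδ0 h) ?_ (integral_nonneg fun t => norm_nonneg _)
          (by positivity)
        exact setIntegral_le_integral hΨ.norm (Eventually.of_forall fun t => norm_nonneg _)
      linarith
  have hbs : Summable fun j : ℕ => 4 * C * (1 / 2 : ℝ) ^ j * K :=
    ((summable_geometric_of_lt_one (by norm_num) (by norm_num)).mul_left _).mul_right _
  have hterm : ∀ ε, 0 < ε → ∀ j : ℕ, ‖4 * C * (1 / 2 : ℝ) ^ j * G (2 ^ j * ε)‖ ≤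
      4 * C * (1 / 2 : ℝ) ^ j * K := fun ε hε j => by
    have h0 := hG0 (2 ^ j * ε) (by positivity)
    rw [Real.norm_of_nonneg (by positivity)]
    exact mul_le_mul_of_nonneg_left (hK _ (by positivity)) (by positivity)
  have hlim : Tendsto (fun ε : ℝ => ∑' j : ℕ, 4 * C * (1 / 2 : ℝ) ^ j * G (2 ^ j * ε))
      (𝓝[>] 0) (𝓝 (∑' _ : ℕ, 0)) := by
    refine tendsto_tsum_of_dominated_convergence hbs (fun j => ?_) ?_
    · have h4 : Tendsto (fun ε : ℝ => 2 ^ j * ε) (𝓝[>] 0) (𝓝[>] 0) := by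
        refine tendsto_nhdsWithin_iff.2 ⟨?_, ?_⟩
        · have : Tendsto (fun ε : ℝ => 2 ^ j * ε) (𝓝 0) (𝓝 (2 ^ j * 0)) :=
            tendsto_id.const_mul _
          rw [mul_zero] at this
          exact this.mono_left nhdsWithin_le_nhds
        · filter_upwards [self_mem_nhdsWithin] with ε hε
          have : (0 : ℝ) < ε := hε
          show (0 : ℝ) < 2 ^ j * ε
          positivity
      have := (hL.comp h4).const_mul (4 * C * (1 / 2 : ℝ) ^ j)
      rwa [mul_zero] at this
    · filter_upwards [self_mem_nhdsWithin] with ε hε j using hterm ε hε j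
  rw [tsum_zero] at hlim
  refine squeeze_zero_norm' ?_ hlim
  filter_upwards [h1, h2, self_mem_nhdsWithin] with ε he1 he2 hε
  exact norm_integral_mul_le_tsum_dyadic hΨ hε hC he1 he2
    (Summable.of_norm_bounded hbs (hterm ε hε))

/-! ### Kernel estimates and Fatou's theorem -/

/-- For interior `θ`, `|t - θ| / 2` stays at distance from `π`, so the sine vanishes only at `t =
θ`. With `u = |t - θ| / 4`, `sin 2u = 2 sin u cos u`; Jordan's inequality bounds `sin u`, and `u ≤
(π + |θ|) / 4 < π / 2` bounds `cos u`. -/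
theorem exists_mul_abs_le_abs_sin {θ : ℝ} (hθ : θ ∈ Set.Ioo (-Real.pi) Real.pi) :
    ∃ c > 0, ∀ t ∈ Set.Icc (-Real.pi) Real.pi, c * |t - θ| ≤ |Real.sin ((t - θ) / 2)| := by
  have hpi := Real.pi_pos
  have hθ' : |θ| < Real.pi := abs_lt.2 hθ
  have hcos : 0 < Real.cos ((Real.pi + |θ|) / 4) :=
    Real.cos_pos_of_mem_Ioo ⟨by linarith [abs_nonneg θ], by linarith⟩
  refine ⟨1 / Real.pi * Real.cos ((Real.pi + |θ|) / 4), by positivity, fun t ht => ?_⟩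
  have ht' : |t - θ| ≤ Real.pi + |θ| := (abs_sub t θ).trans (by linarith [abs_le.2 ht])
  have hsin : |Real.sin ((t - θ) / 2)| = Real.sin (|t - θ| / 2) := by
    have h2 : |(t - θ) / 2| = |t - θ| / 2 := by rw [abs_div, abs_two]
    rw [← h2]
    exact Real.abs_sin_eq_sin_abs_of_abs_le_pi (by rw [h2]; linarith)
  have h1 := Real.mul_le_sin (x := |t - θ| / 4) (by positivity) (by linarith)
  have h2 : Real.cos ((Real.pi + |θ|) / 4) ≤ Real.cos (|t - θ| / 4) :=
    Real.cos_le_cos_of_nonneg_of_le_pi (by positivity) (by linarith) (by linarith)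
  rw [hsin, show |t - θ| / 2 = 2 * (|t - θ| / 4) by ring, Real.sin_two_mul]
  have h3 : 2 / Real.pi * (|t - θ| / 4) * Real.cos ((Real.pi + |θ|) / 4) ≤
      Real.sin (|t - θ| / 4) * Real.cos (|t - θ| / 4) :=
    mul_le_mul h1 h2 hcos.le ((by positivity : (0 : ℝ) ≤ _).trans h1)
  calc _ = 2 * (2 / Real.pi * (|t - θ| / 4) * Real.cos ((Real.pi + |θ|) / 4)) := by ring
    _ ≤ 2 * (Real.sin (|t - θ| / 4) * Real.cos (|t - θ| / 4)) := by linarith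
    _ = _ := by ring

theorem norm_one_sub_exp_I_mul (s : ℝ) :
    ‖1 - Complex.exp (Complex.I * s)‖ = 2 * |Real.sin (s / 2)| := by
  rw [norm_sub_rev, Complex.norm_exp_I_mul_ofReal_sub_one, norm_mul, Real.norm_eq_abs,
    Real.norm_eq_abs, abs_two]

theorem le_norm_one_sub_mul_exp {ε : ℝ} (hε1 : ε ≤ 1) (s : ℝ) :
    ε ≤ ‖1 - (1 - ε : ℝ) * Complex.exp (Complex.I * s)‖ := by
  have := norm_sub_norm_le 1 ((1 - ε : ℝ) * Complex.exp (Complex.I * s))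
  rw [norm_mul, norm_exp_I_mul, norm_one, mul_one, Complex.norm_real,
    Real.norm_of_nonneg (by linarith)] at this
  linarith

/-- The triangle inequality gives `2 |sin (s/2)| = ‖1 - e^{is}‖ ≤ ‖1 - (1 - ε) e^{is}‖ + ε`, and `ε`
is itself at most that norm. -/
theorem abs_sin_le_norm_one_sub_mul_exp {ε : ℝ} (hε : 0 ≤ ε) (hε1 : ε ≤ 1) (s : ℝ) :
    |Real.sin (s / 2)| ≤ ‖1 - (1 - ε : ℝ) * Complex.exp (Complex.I * s)‖ := by
  have h1 := le_norm_one_sub_mul_exp hε1 s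
  have h2 := norm_sub_le (1 - (1 - ε : ℝ) * Complex.exp (Complex.I * s))
    (ε * Complex.exp (Complex.I * s))
  have h3 : 1 - (1 - ε : ℝ) * Complex.exp (Complex.I * s) - ε * Complex.exp (Complex.I * s) =
      1 - Complex.exp (Complex.I * s) := by push_cast; ring
  rw [h3, norm_one_sub_exp_I_mul, norm_mul, norm_exp_I_mul, mul_one, Complex.norm_real,
    Real.norm_of_nonneg hε] at h2
  linarith

theorem tendsto_one_sub_nhdsLT_one :
    Tendsto (fun ρ : ℝ => 1 - ρ) (𝓝[<] 1) (𝓝[>] 0) := by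
  refine tendsto_nhdsWithin_iff.2 ⟨?_, ?_⟩
  · have : Tendsto (fun ρ : ℝ => 1 - ρ) (𝓝 1) (𝓝 (1 - 1)) := tendsto_id.const_sub _
    rw [sub_self] at this
    exact this.mono_left nhdsWithin_le_nhds
  · filter_upwards [self_mem_nhdsWithin] with ρ hρ
    have : ρ < 1 := hρ
    show 0 < 1 - ρ
    linarith

theorem norm_ofReal_mul_exp {ρ : ℝ} (hρ : 0 ≤ ρ) (θ : ℝ) :
    ‖(ρ : ℂ) * Complex.exp (Complex.I * θ)‖ = ρ := by
  rw [norm_mul, norm_exp_I_mul, mul_one, Complex.norm_real, Real.norm_of_nonneg hρ]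

/-- Fatou's theorem on radial limits of Poisson integrals. -/
theorem tendsto_re_innerAnalytic {f : ℝ → ℝ} (hf : Integrable f arcMeasure) {θ : ℝ}
    (hθ : θ ∈ Set.Ioo (-Real.pi) Real.pi) (hL : IsLebesguePoint (fun t => (f t : ℂ)) θ) :
    Tendsto (fun ρ : ℝ => (innerAnalytic f ((ρ : ℂ) * Complex.exp (Complex.I * (θ : ℂ)))).re)
      (𝓝[<] 1) (𝓝 (f θ)) := by
  obtain ⟨c, hc, hsin⟩ := exists_mul_abs_le_abs_sin hθ
  have hpi := Real.pi_pos
  have hd : Integrable (fun t => f t - f θ) arcMeasure := hf.sub (integrable_const _)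
  -- The Poisson kernel with `ε = 1 - ρ`. Its numerator is at most `2ε` and its denominator at least
  -- both `ε²` and `c² (t - θ)²`, which explains the constants `2` and `2 / c²`.
  set P : ℝ → ℝ → ℝ := fun ε t =>
    (1 - (1 - ε) ^ 2) / ‖1 - (1 - ε : ℝ) * Complex.exp (Complex.I * (θ - t : ℝ))‖ ^ 2 with hP
  have hlim : Tendsto (fun ε => ∫ t, (P ε t : ℂ) * ((f t : ℂ) - f θ) ∂arcMeasure) (𝓝[>] 0)
      (𝓝 0) := by
    refine tendsto_integral_kernel_mul ((integrable_ofReal hf).sub (integrable_const _))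
      (C := max 2 (2 / c ^ 2)) hL (by positivity) ?_ ?_
    · filter_upwards [Ioc_mem_nhdsGT (zero_lt_one)] with ε hε
      have hε0 := hε.1
      refine Eventually.of_forall fun t => ?_
      have h1 := le_norm_one_sub_mul_exp hε.2 (θ - t)
      rw [Complex.norm_real, Real.norm_of_nonneg (div_nonneg (by nlinarith [hε.1, hε.2])
        (by positivity))]
      calc _ ≤ 2 * ε / ε ^ 2 := by
            refine div_le_div₀ (by linarith) (by nlinarith) (by positivity) ?_
            gcongr
        _ = 2 / ε := by field_simp
        _ ≤ _ := by gcongr; exact le_max_left _ _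
    · filter_upwards [Ioc_mem_nhdsGT (zero_lt_one)] with ε hε
      have hε0 := hε.1
      filter_upwards [ae_restrict_mem measurableSet_Icc] with t ht
      have h0 := le_norm_one_sub_mul_exp hε.2 (θ - t)
      have h1 := abs_sin_le_norm_one_sub_mul_exp hε.1.le hε.2 (θ - t)
      have h2 := hsin t ht
      rw [show (θ - t) / 2 = -((t - θ) / 2) by ring, Real.sin_neg, abs_neg] at h1
      have h3 := h2.trans h1
      rw [Complex.norm_real, Real.norm_of_nonneg (div_nonneg (by nlinarith [hε.1, hε.2])
        (by positivity)), div_mul_eq_mul_div, div_le_iff₀ (pow_pos (hε0.trans_le h0) 2)]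
      have h4 : (c * |t - θ|) ^ 2 ≤
          ‖1 - (1 - ε : ℝ) * Complex.exp (Complex.I * (θ - t : ℝ))‖ ^ 2 := by
        gcongr
      rw [mul_pow, sq_abs] at h4
      calc (1 - (1 - ε) ^ 2) * (t - θ) ^ 2 ≤ (2 * ε) * (t - θ) ^ 2 := by
            gcongr; nlinarith
        _ = 2 / c ^ 2 * ε * (c ^ 2 * (t - θ) ^ 2) := by field_simp
        _ ≤ max 2 (2 / c ^ 2) * ε * (c ^ 2 * (t - θ) ^ 2) := by gcongr; exact le_max_right _ _
        _ ≤ _ := by gcongr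
  have h2 := ((Complex.continuous_re.tendsto _).comp (hlim.comp tendsto_one_sub_nhdsLT_one)).const_mul
    (1 / (2 * Real.pi))
  have h3 := h2.add_const (f θ)
  rw [Complex.zero_re, mul_zero, zero_add] at h3
  refine h3.congr' ?_
  filter_upwards [Ioo_mem_nhdsLT (zero_lt_one)] with ρ hρ
  have hz : ‖(ρ : ℂ) * Complex.exp (Complex.I * θ)‖ < 1 := by
    rw [norm_ofReal_mul_exp hρ.1.le]; exact hρ.2
  have h4 := innerAnalytic_sub hf (integrable_const (f θ)) hz
  rw [innerAnalytic_const] at h4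
  have h5 := congrArg Complex.re h4
  rw [Complex.sub_re, Complex.ofReal_re, re_innerAnalytic hd hz, norm_ofReal_mul_exp hρ.1.le] at h5
  have h6 : ∀ t : ℝ, (ρ : ℂ) * Complex.exp (Complex.I * θ) * Complex.exp (-(Complex.I * t)) =
      ρ * Complex.exp (Complex.I * (θ - t : ℝ)) := fun t => by
    rw [mul_assoc, ← Complex.exp_add]; push_cast; ring_nf
  simp only [h6] at h5
  have h7 : ∀ t : ℝ, (P (1 - ρ) t : ℂ) * ((f t : ℂ) - f θ) = ((P (1 - ρ) t * (f t - f θ) : ℝ) : ℂ) :=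
    fun t => by push_cast; rfl
  simp only [Function.comp, h7]
  rw [integral_complex_ofReal, Complex.ofReal_re]
  simp only [hP, sub_sub_cancel]
  linarith

/-! ### Smirnov's theorem for differences of functions with nonnegative real part -/

theorem ofReal_mul_exp_mem_ball {ρ : ℝ} (hρ : 0 ≤ ρ) (hρ1 : ρ < 1) (θ : ℝ) :
    (ρ : ℂ) * Complex.exp (Complex.I * θ) ∈ Metric.ball (0 : ℂ) 1 := by
  rw [mem_ball_zero_iff, norm_ofReal_mul_exp hρ]
  exact hρ1

theorem continuous_on_circle {h : ℂ → ℂ} (hh : DifferentiableOn ℂ h (Metric.ball 0 1)) {ρ : ℝ}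
    (hρ : 0 ≤ ρ) (hρ1 : ρ < 1) :
    Continuous fun θ : ℝ => h ((ρ : ℂ) * Complex.exp (Complex.I * θ)) :=
  hh.continuousOn.comp_continuous (by fun_prop) fun θ => ofReal_mul_exp_mem_ball hρ hρ1 θ

theorem integral_circle_eq {h : ℂ → ℂ} (hh : DifferentiableOn ℂ h (Metric.ball 0 1)) {ρ : ℝ}
    (hρ : 0 ≤ ρ) (hρ1 : ρ < 1) :
    ∫ θ : ℝ, h ((ρ : ℂ) * Complex.exp (Complex.I * θ)) ∂arcMeasure = 2 * Real.pi * h 0 := by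
  have hsub : Metric.closedBall (0 : ℂ) ρ ⊆ Metric.ball 0 1 :=
    Metric.closedBall_subset_ball hρ1
  have h1 : DiffContOnCl ℂ h (Metric.ball 0 |ρ|) := by
    rw [abs_of_nonneg hρ]
    refine (hh.mono ?_).diffContOnCl
    exact Metric.closure_ball_subset_closedBall.trans hsub
  have h2 := h1.circleAverage
  have hper : Function.Periodic (fun θ : ℝ => h (circleMap 0 ρ θ)) (2 * Real.pi) := fun θ => by
    simp only [periodic_circleMap 0 ρ θ]
  have h3 := hper.intervalIntegral_add_eq 0 (-Real.pi)
  rw [zero_add, show -Real.pi + 2 * Real.pi = Real.pi by ring] at h3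
  rw [Real.circleAverage_def, h3] at h2
  rw [← h2, ← intervalIntegral_eq_integral_arcMeasure]
  have hpi : (Real.pi : ℂ) ≠ 0 := by exact_mod_cast Real.pi_ne_zero
  have hcm : ∀ θ : ℝ, circleMap 0 ρ θ = ρ * Complex.exp (Complex.I * θ) := fun θ => by
    rw [circleMap_zero, mul_comm Complex.I]
  simp only [hcm, Complex.real_smul]
  push_cast
  field_simp

theorem one_le_norm_one_add_mul {ε : ℝ} (hε : 0 ≤ ε) {u : ℂ} (hu : 0 ≤ u.re) :
    1 ≤ ‖1 + ε * u‖ := by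
  have h := Complex.abs_re_le_norm (1 + ε * u)
  rw [Complex.add_re, Complex.one_re, Complex.re_ofReal_mul] at h
  have : 0 ≤ ε * u.re := by positivity
  exact (le_abs_self _).trans' (by linarith) |>.trans h

theorem mul_norm_le_norm_one_add_mul {ε : ℝ} (hε : 0 ≤ ε) {u : ℂ} (hu : 0 ≤ u.re) :
    ε * ‖u‖ ≤ ‖1 + ε * u‖ := by
  have h0 : 0 ≤ (ε * u).re := by rw [Complex.re_ofReal_mul]; positivity
  have h1 : ‖(ε * u : ℂ)‖ = ε * ‖u‖ := by
    rw [norm_mul, Complex.norm_real, Real.norm_of_nonneg hε]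
  rw [← h1]
  refine le_of_sq_le_sq ?_ (norm_nonneg _)
  rw [← Complex.normSq_eq_norm_sq, ← Complex.normSq_eq_norm_sq]
  simp only [Complex.normSq_apply, Complex.add_re, Complex.add_im, Complex.one_re, Complex.one_im]
  nlinarith

/-- With `A` and `B` the norms of the two factors, both at least 1, `ε ‖u - v‖ ≤ A + B ≤ 2AB`. So
the regularized difference is bounded, which permits dominated convergence. -/
theorem norm_mul_inv_le {ε : ℝ} (hε : 0 < ε) {u v : ℂ} (hu : 0 ≤ u.re) (hv : 0 ≤ v.re) :
    ‖(u - v) * ((1 + ε * u) * (1 + ε * v))⁻¹‖ ≤ 2 / ε := by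
  have hu1 := one_le_norm_one_add_mul hε.le hu
  have hv1 := one_le_norm_one_add_mul hε.le hv
  have hu2 := mul_norm_le_norm_one_add_mul hε.le hu
  have hv2 := mul_norm_le_norm_one_add_mul hε.le hv
  rw [norm_mul, norm_inv, norm_mul, ← div_eq_mul_inv,
    div_le_div_iff₀ (by nlinarith) hε]
  have h1 : ‖u - v‖ * ε ≤ ‖1 + ε * u‖ + ‖1 + ε * v‖ := by
    have := mul_le_mul_of_nonneg_right (norm_sub_le u v) hε.le
    linarith
  nlinarith

theorem norm_one_sub_sq_le {r : ℂ} (hr : ‖r‖ ≤ 1) : ‖1 - r‖ ^ 2 ≤ 2 - 2 * r.re := by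
  have h : ‖r‖ ^ 2 ≤ 1 := pow_le_one₀ (norm_nonneg _) hr
  rw [← Complex.normSq_eq_norm_sq] at *
  simp only [Complex.normSq_apply, Complex.sub_re, Complex.sub_im, Complex.one_re,
    Complex.one_im] at *
  nlinarith

/-- AM-GM applied to `‖1 - r‖² ≤ 2 - 2 Re r`. The bound is affine in `Re r`, so its circle integral
needs only the mean value of an analytic function. -/
theorem norm_one_sub_le_add_div {r : ℂ} (hr : ‖r‖ ≤ 1) {s : ℝ} (hs : 0 < s) :
    ‖1 - r‖ ≤ s + (2 - 2 * r.re) / s := by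
  have h := norm_one_sub_sq_le hr
  have h1 : ‖1 - r‖ * s ≤ s * s + (2 - 2 * r.re) := by
    nlinarith [sq_nonneg (‖1 - r‖ - s), norm_nonneg (1 - r)]
  rw [← sub_nonneg]
  have : s + (2 - 2 * r.re) / s - ‖1 - r‖ = (s * s + (2 - 2 * r.re) - ‖1 - r‖ * s) / s := by
    field_simp
  rw [this]
  exact div_nonneg (by linarith) hs.le

/-- Truncates `‖a‖` at height `K`: the excess meets `‖1 - r‖ ≤ 2`, the rest meets the affine bound.
-/
theorem norm_mul_one_sub_le {a r : ℂ} (hr : ‖r‖ ≤ 1) {s K : ℝ} (hs : 0 < s) (hK : 0 ≤ K) :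
    ‖a * (1 - r)‖ ≤ 2 * max (‖a‖ - K) 0 + K * (s + (2 - 2 * r.re) / s) := by
  have h1 := norm_one_sub_le_add_div hr hs
  have h2 : ‖1 - r‖ ≤ 2 := (norm_sub_le _ _).trans (by rw [norm_one]; linarith)
  have h3 : ‖a‖ ≤ max (‖a‖ - K) 0 + K := by linarith [le_max_left (‖a‖ - K) 0]
  have h4 : 0 ≤ max (‖a‖ - K) 0 := le_max_right _ _
  rw [norm_mul]
  calc ‖a‖ * ‖1 - r‖ ≤ (max (‖a‖ - K) 0 + K) * ‖1 - r‖ := by gcongr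
    _ = ‖1 - r‖ * max (‖a‖ - K) 0 + K * ‖1 - r‖ := by ring
    _ ≤ _ := by gcongr

/-- Smirnov's theorem: an analytic function on the disc that is a difference of two functions with
nonnegative real part and has integrable radial limits is represented by them; if it vanishes at
`0`, then the nonpositive Fourier coefficients of the radial limits vanish. -/
theorem integral_exp_mul_radialLimit_eq_zero {w₁ w₂ : ℂ → ℂ}
    (hd₁ : DifferentiableOn ℂ w₁ (Metric.ball 0 1)) (hd₂ : DifferentiableOn ℂ w₂ (Metric.ball 0 1))
    (hre₁ : ∀ z ∈ Metric.ball (0 : ℂ) 1, 0 ≤ (w₁ z).re)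
    (hre₂ : ∀ z ∈ Metric.ball (0 : ℂ) 1, 0 ≤ (w₂ z).re) (h0 : w₁ 0 = w₂ 0)
    {Φ : ℝ → ℂ} (hΦ : Integrable Φ arcMeasure)
    (hlim : ∀ᵐ θ : ℝ ∂arcMeasure, Tendsto (fun ρ : ℝ => w₁ (ρ * Complex.exp (Complex.I * (θ : ℂ))) -
      w₂ (ρ * Complex.exp (Complex.I * (θ : ℂ)))) (𝓝[<] 1) (𝓝 (Φ θ))) (k : ℕ) :
    ∫ θ : ℝ, Complex.exp (Complex.I * θ) ^ k * Φ θ ∂arcMeasure = 0 := by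
  have hpi := Real.pi_pos
  set e : ℝ → ℂ := fun θ => Complex.exp (Complex.I * θ) with he
  have hec : Continuous e := by fun_prop
  have hen : ∀ θ, ‖e θ ^ k‖ = 1 := fun θ => by rw [norm_pow, he, norm_exp_I_mul, one_pow]
  -- An analytic multiplier with `‖R ε z‖ ≤ 1` that makes `R ε * (w₁ - w₂)` bounded by `2 / ε` and
  -- tends to 1 at the origin as `ε → 0`.
  set R : ℝ → ℂ → ℂ := fun ε z => ((1 + ε * w₁ z) * (1 + ε * w₂ z))⁻¹ with hR
  have hR1 : ∀ ε, 0 ≤ ε → ∀ z ∈ Metric.ball (0 : ℂ) 1, ‖R ε z‖ ≤ 1 := fun ε hε z hz => by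
    rw [hR, norm_inv, norm_mul]
    exact inv_le_one_of_one_le₀ (one_le_mul_of_one_le_of_one_le
      (one_le_norm_one_add_mul hε (hre₁ z hz)) (one_le_norm_one_add_mul hε (hre₂ z hz)))
  have hRd : ∀ ε, 0 ≤ ε → DifferentiableOn ℂ (R ε) (Metric.ball 0 1) := fun ε hε => by
    refine DifferentiableOn.inv ?_ fun z hz => ?_
    · exact ((hd₁.const_mul _).const_add _).mul ((hd₂.const_mul _).const_add _)
    · refine mul_ne_zero ?_ ?_ <;> rw [← norm_pos_iff]
      · exact zero_lt_one.trans_le (one_le_norm_one_add_mul hε (hre₁ z hz))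
      · exact zero_lt_one.trans_le (one_le_norm_one_add_mul hε (hre₂ z hz))
  have hmean : ∀ ε, 0 ≤ ε → ∀ ρ ∈ Set.Ioo (0 : ℝ) 1,
      ∫ θ, e θ ^ k * R ε (ρ * e θ) * (w₁ (ρ * e θ) - w₂ (ρ * e θ)) ∂arcMeasure = 0 := by
    intro ε hε ρ hρ
    have hdiff : DifferentiableOn ℂ (fun z => z ^ k * R ε z * (w₁ z - w₂ z)) (Metric.ball 0 1) :=
      ((differentiableOn_id.pow k).mul (hRd ε hε)).mul (hd₁.sub hd₂)
    have h := integral_circle_eq hdiff hρ.1.le hρ.2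
    rw [h0, sub_self, mul_zero, mul_zero] at h
    have h2 : ∀ θ : ℝ, (ρ * e θ) ^ k * R ε (ρ * e θ) * (w₁ (ρ * e θ) - w₂ (ρ * e θ)) =
        (ρ : ℂ) ^ k * (e θ ^ k * R ε (ρ * e θ) * (w₁ (ρ * e θ) - w₂ (ρ * e θ))) := fun θ => by
      rw [mul_pow]; ring
    have h3 : (ρ : ℂ) ^ k *
        ∫ θ, e θ ^ k * R ε (ρ * e θ) * (w₁ (ρ * e θ) - w₂ (ρ * e θ)) ∂arcMeasure = 0 := by
      rw [← integral_const_mul, ← h]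
      exact integral_congr_ae (Eventually.of_forall fun θ => (h2 θ).symm)
    refine (mul_eq_zero.1 h3).resolve_left (pow_ne_zero _ ?_)
    exact_mod_cast hρ.1.ne'
  have hmem : ∀ ρ ∈ Set.Ioo (0 : ℝ) 1, ∀ θ, (ρ : ℂ) * e θ ∈ Metric.ball (0 : ℂ) 1 :=
    fun ρ hρ θ => ofReal_mul_exp_mem_ball hρ.1.le hρ.2 θ
  have hRc : ∀ ε, 0 ≤ ε → ∀ ρ ∈ Set.Ioo (0 : ℝ) 1, Continuous fun θ => R ε (ρ * e θ) :=
    fun ε hε ρ hρ => continuous_on_circle (hRd ε hε) hρ.1.le hρ.2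
  have hRΦ : ∀ ε, 0 ≤ ε → ∀ ρ ∈ Set.Ioo (0 : ℝ) 1,
      Integrable (fun θ => e θ ^ k * R ε (ρ * e θ) * Φ θ) arcMeasure := fun ε hε ρ hρ => by
    refine hΦ.bdd_mul (c := 1) ((hec.pow k).mul (hRc ε hε ρ hρ)).aestronglyMeasurable
      (Eventually.of_forall fun θ => ?_)
    rw [norm_mul, hen, one_mul]
    exact hR1 ε hε _ (hmem ρ hρ θ)
  -- Only `w₁ - w₂` is replaced by its limit `Φ`, while `R ε` stays at radius `ρ`. Hence radial
  -- limits of `w₁` and `w₂` separately are never needed.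
  have hradial : ∀ ε, 0 < ε →
      Tendsto (fun ρ : ℝ => ∫ θ, e θ ^ k * R ε (ρ * e θ) * Φ θ ∂arcMeasure) (𝓝[<] 1) (𝓝 0) := by
    intro ε hε
    have hev : ∀ᶠ ρ : ℝ in 𝓝[<] 1, ρ ∈ Set.Ioo (0 : ℝ) 1 := Ioo_mem_nhdsLT zero_lt_one
    have h1 : Tendsto (fun ρ : ℝ => ∫ θ, (e θ ^ k * R ε (ρ * e θ) * Φ θ -
        e θ ^ k * R ε (ρ * e θ) * (w₁ (ρ * e θ) - w₂ (ρ * e θ))) ∂arcMeasure) (𝓝[<] 1)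
        (𝓝 (∫ _, 0 ∂arcMeasure)) := by
      refine tendsto_integral_filter_of_dominated_convergence (fun θ => ‖Φ θ‖ + 2 / ε) ?_ ?_
        (hΦ.norm.add (integrable_const _)) ?_
      · filter_upwards [hev] with ρ hρ
        refine (hRΦ ε hε.le ρ hρ).1.sub (Continuous.aestronglyMeasurable ?_)
        exact ((hec.pow k).mul (hRc ε hε.le ρ hρ)).mul
          ((continuous_on_circle hd₁ hρ.1.le hρ.2).sub (continuous_on_circle hd₂ hρ.1.le hρ.2))
      · filter_upwards [hev] with ρ hρ
        refine Eventually.of_forall fun θ => ?_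
        refine (norm_sub_le _ _).trans (add_le_add ?_ ?_)
        · rw [norm_mul, norm_mul, hen, one_mul]
          exact mul_le_of_le_one_left (norm_nonneg _) (hR1 ε hε.le _ (hmem ρ hρ θ))
        · rw [mul_assoc, norm_mul, hen, one_mul, mul_comm]
          exact norm_mul_inv_le hε (hre₁ _ (hmem ρ hρ θ)) (hre₂ _ (hmem ρ hρ θ))
      · filter_upwards [hlim] with θ hθ
        have h2 := (hθ.const_sub (Φ θ)).norm
        rw [sub_self, norm_zero] at h2
        refine squeeze_zero_norm' ?_ h2
        filter_upwards [hev] with ρ hρ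
        rw [← mul_sub, norm_mul, norm_mul, hen, one_mul]
        exact mul_le_of_le_one_left (norm_nonneg _) (hR1 ε hε.le _ (hmem ρ hρ θ))
    rw [integral_zero] at h1
    refine h1.congr' ?_
    filter_upwards [hev] with ρ hρ
    rw [integral_sub (hRΦ ε hε.le ρ hρ), hmean ε hε.le ρ hρ, sub_zero]
    exact (((hec.pow k).mul (hRc ε hε.le ρ hρ)).mul ((continuous_on_circle hd₁ hρ.1.le hρ.2).sub
      (continuous_on_circle hd₂ hρ.1.le hρ.2))).integrableOn_Icc
  -- By `hradial` the integral is the limit of `∫ e^k Φ (1 - R ε)` as `ρ → 1`. The mean of `Re R ε`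
  -- on each circle is `Re R ε 0`, so the bound does not depend on `ρ`.
  have hmain : ∀ ε, 0 < ε → ∀ K, 0 ≤ K → ∀ s, 0 < s →
      ‖∫ θ, e θ ^ k * Φ θ ∂arcMeasure‖ ≤ 2 * ∫ θ, max (‖Φ θ‖ - K) 0 ∂arcMeasure +
        K * (2 * Real.pi * s + 4 * Real.pi / s * (1 - (R ε 0).re)) := by
    intro ε hε K hK s hs
    have h1 := (hradial ε hε).const_sub (∫ θ, e θ ^ k * Φ θ ∂arcMeasure)
    rw [sub_zero] at h1
    refine le_of_tendsto h1.norm ?_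
    filter_upwards [Ioo_mem_nhdsLT (zero_lt_one' ℝ)] with ρ hρ
    have hi1 : Integrable (fun θ => e θ ^ k * Φ θ) arcMeasure :=
      hΦ.bdd_mul (c := 1) (hec.pow k).aestronglyMeasurable
        (Eventually.of_forall fun θ => (hen θ).le)
    have hRi : Integrable (fun θ => R ε (ρ * e θ)) arcMeasure :=
      (integrable_const (1 : ℝ)).mono' (hRc ε hε.le ρ hρ).aestronglyMeasurable
        (Eventually.of_forall fun θ => hR1 ε hε.le _ (hmem ρ hρ θ))
    have hi2 : Integrable (fun θ => 2 * max (‖Φ θ‖ - K) 0) arcMeasure :=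
      ((hΦ.norm.sub (integrable_const K)).pos_part).const_mul 2
    have hRre : Integrable (fun θ => (R ε (ρ * e θ)).re) arcMeasure := hRi.re
    have hi4 : Integrable (fun θ => (2 - 2 * (R ε (ρ * e θ)).re) / s) arcMeasure :=
      ((integrable_const 2).sub (hRi.re.const_mul 2)).div_const s
    have hi3 : Integrable (fun θ => K * (s + (2 - 2 * (R ε (ρ * e θ)).re) / s)) arcMeasure :=
      ((integrable_const s).add hi4).const_mul K
    have hval : ∫ θ, K * (s + (2 - 2 * (R ε (ρ * e θ)).re) / s) ∂arcMeasure =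
        K * (2 * Real.pi * s + 4 * Real.pi / s * (1 - (R ε 0).re)) := by
      have h2 := congrArg Complex.re (integral_circle_eq (hRd ε hε.le) hρ.1.le hρ.2)
      rw [← RCLike.re_eq_complex_re, ← integral_re hRi] at h2
      have h3 : ((2 : ℂ) * Real.pi * R ε 0).re = 2 * Real.pi * (R ε 0).re := by
        rw [show (2 : ℂ) * Real.pi = ((2 * Real.pi : ℝ) : ℂ) by push_cast; rfl,
          Complex.re_ofReal_mul]
      simp only [RCLike.re_eq_complex_re] at h2
      rw [h3] at h2
      rw [integral_const_mul, integral_add (integrable_const _) hi4, integral_div,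
        integral_sub (integrable_const _) (hRre.const_mul 2), integral_const_mul,
        integral_const, integral_const, arcMeasure_real_univ]
      simp only [smul_eq_mul]
      rw [h2]
      field_simp
      ring
    rw [← integral_sub hi1 (hRΦ ε hε.le ρ hρ), ← hval, ← integral_const_mul,
      ← integral_add hi2 hi3]
    refine norm_integral_le_of_norm_le (hi2.add hi3) (Eventually.of_forall fun θ => ?_)
    have h5 : e θ ^ k * Φ θ - e θ ^ k * R ε (ρ * e θ) * Φ θ =
        e θ ^ k * (Φ θ * (1 - R ε (ρ * e θ))) := by ring
    rw [h5, norm_mul, hen, one_mul]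
    exact norm_mul_one_sub_le (hR1 ε hε.le _ (hmem ρ hρ θ)) hs hK
  -- The remaining limits are `ε → 0`, then `s → 0`, then `K → ∞`; the order matters, since `4π / s`
  -- and `K` multiply terms that must already have vanished.
  have hR0 : Tendsto (fun ε : ℝ => (R ε 0).re) (𝓝[>] 0) (𝓝 1) := by
    have h1 : ContinuousAt (fun ε : ℝ => (R ε 0).re) 0 := by
      refine Complex.continuous_re.continuousAt.comp (ContinuousAt.inv₀ (by fun_prop) ?_)
      simp
    have h2 : (R 0 0).re = 1 := by simp [hR]
    have h3 := h1.tendsto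
    rw [h2] at h3
    exact h3.mono_left nhdsWithin_le_nhds
  have hmain2 : ∀ K, 0 ≤ K → ∀ s, 0 < s →
      ‖∫ θ, e θ ^ k * Φ θ ∂arcMeasure‖ ≤ 2 * ∫ θ, max (‖Φ θ‖ - K) 0 ∂arcMeasure +
        K * (2 * Real.pi * s) := by
    intro K hK s hs
    have h1 : Tendsto (fun ε : ℝ => 2 * ∫ θ, max (‖Φ θ‖ - K) 0 ∂arcMeasure +
        K * (2 * Real.pi * s + 4 * Real.pi / s * (1 - (R ε 0).re))) (𝓝[>] 0)
        (𝓝 (2 * ∫ θ, max (‖Φ θ‖ - K) 0 ∂arcMeasure +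
        K * (2 * Real.pi * s + 4 * Real.pi / s * (1 - 1)))) :=
      ((((hR0.const_sub 1).const_mul _).const_add _).const_mul K).const_add _
    rw [sub_self, mul_zero, add_zero] at h1
    refine ge_of_tendsto h1 ?_
    filter_upwards [self_mem_nhdsWithin] with ε hε using hmain ε hε K hK s hs
  have hmain3 : ∀ K, 0 ≤ K →
      ‖∫ θ, e θ ^ k * Φ θ ∂arcMeasure‖ ≤ 2 * ∫ θ, max (‖Φ θ‖ - K) 0 ∂arcMeasure := by
    intro K hK
    have h1 : Tendsto (fun s : ℝ => 2 * ∫ θ, max (‖Φ θ‖ - K) 0 ∂arcMeasure +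
        K * (2 * Real.pi * s)) (𝓝[>] 0) (𝓝 (2 * ∫ θ, max (‖Φ θ‖ - K) 0 ∂arcMeasure +
        K * (2 * Real.pi * 0))) :=
      (((tendsto_id.mono_left nhdsWithin_le_nhds).const_mul _).const_mul K).const_add _
    rw [mul_zero, mul_zero, add_zero] at h1
    refine ge_of_tendsto h1 ?_
    filter_upwards [self_mem_nhdsWithin] with s hs using hmain2 K hK s hs
  have hK : Tendsto (fun K : ℕ => ∫ θ, max (‖Φ θ‖ - (K : ℝ)) 0 ∂arcMeasure) atTop
      (𝓝 (∫ _, (0 : ℝ) ∂arcMeasure)) := by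
    refine tendsto_integral_of_dominated_convergence (fun θ => ‖Φ θ‖)
      (fun K => (hΦ.norm.sub (integrable_const (K : ℝ))).pos_part.1) hΦ.norm
      (fun K => Eventually.of_forall fun θ => ?_) (Eventually.of_forall fun θ => ?_)
    · rw [Real.norm_of_nonneg (le_max_right _ _)]
      exact max_le (by linarith [K.cast_nonneg (α := ℝ)]) (norm_nonneg _)
    · refine tendsto_const_nhds.congr' ?_
      filter_upwards [eventually_ge_atTop ⌈‖Φ θ‖⌉₊] with K hK
      rw [max_eq_right]
      linarith [Nat.ceil_le.1 hK]
  rw [integral_zero] at hK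
  have h2 := hK.const_mul 2
  rw [mul_zero] at h2
  exact norm_le_zero_iff.1 (ge_of_tendsto h2 (Eventually.of_forall fun K =>
    hmain3 K (Nat.cast_nonneg K)))

/-! ### The singular kernel: algebra and truncated integral -/

/-- The complex kernel `e^{i(k+1/2)s} / sin(s/2)`. -/
noncomputable def cotKernel (k : ℕ) (s : ℝ) : ℂ :=
  Complex.exp (Complex.I * (((k : ℝ) + 1 / 2) * s : ℝ)) / (Real.sin (s / 2) : ℂ)

theorem norm_cotKernel (k : ℕ) (s : ℝ) : ‖cotKernel k s‖ = |Real.sin (s / 2)|⁻¹ := by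
  rw [cotKernel, norm_div, norm_exp_I_mul, Complex.norm_real, Real.norm_eq_abs, one_div]

theorem measurable_cotKernel (k : ℕ) : Measurable (cotKernel k) := by
  unfold cotKernel
  fun_prop

theorem ofReal_sin_half (s : ℝ) :
    (Real.sin (s / 2) : ℂ) = (Complex.exp (Complex.I * (s / 2 : ℝ)) -
      (Complex.exp (Complex.I * (s / 2 : ℝ)))⁻¹) / (2 * Complex.I) := by
  rw [Complex.ofReal_sin, Complex.sin, ← Complex.exp_neg, mul_comm Complex.I, neg_mul]
  have := Complex.I_mul_I
  rw [eq_div_iff (by simp)]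
  linear_combination (Complex.exp (-((s / 2 : ℝ) * Complex.I)) -
    Complex.exp ((s / 2 : ℝ) * Complex.I)) * this

theorem cotKernel_zero {s : ℝ} (hs : Real.sin (s / 2) ≠ 0) :
    cotKernel 0 s = -(2 * Complex.I * Complex.exp (Complex.I * s)) /
      (1 - Complex.exp (Complex.I * s)) := by
  set E := Complex.exp (Complex.I * (s / 2 : ℝ)) with hE
  have hE0 : E ≠ 0 := Complex.exp_ne_zero _
  have hz : Complex.exp (Complex.I * s) = E ^ 2 := by
    rw [hE, ← Complex.exp_nat_mul]; push_cast; ring_nf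
  have hs' : (Real.sin (s / 2) : ℂ) ≠ 0 := by exact_mod_cast hs
  have h1 : E ^ 2 = 1 + 2 * Complex.I * Real.sin (s / 2) * E := by
    rw [ofReal_sin_half, ← hE]
    field_simp
    ring
  have h2 : 1 - E ^ 2 ≠ 0 := by
    rw [h1]
    simp only [sub_add_cancel_left, neg_ne_zero]
    exact mul_ne_zero (mul_ne_zero (by simp) hs') hE0
  have h3 : Complex.exp (Complex.I * (((0 : ℕ) + 1 / 2 : ℝ) * s : ℝ)) = E := by
    rw [hE]; push_cast; ring_nf
  rw [cotKernel, h3, hz, div_eq_div_iff hs' h2]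
  linear_combination (-E) * h1

/-- Telescoping: raising `k` by one multiplies the numerator by `e^{is}`, and `e^{is} - 1 = 2i sin
(s/2) e^{is/2}` cancels the denominator. All added frequencies are positive. -/
theorem cotKernel_eq {s : ℝ} (hs : Real.sin (s / 2) ≠ 0) (k : ℕ) :
    cotKernel k s = cotKernel 0 s +
      ∑ j ∈ Finset.range k, 2 * Complex.I * Complex.exp (Complex.I * s) ^ (j + 1) := by
  induction k with
  | zero => simp
  | succ k ih =>
    rw [Finset.sum_range_succ, ← add_assoc, ← ih, cotKernel, cotKernel]
    set E := Complex.exp (Complex.I * (s / 2 : ℝ)) with hE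
    have hE0 : E ≠ 0 := Complex.exp_ne_zero _
    have hs' : (Real.sin (s / 2) : ℂ) ≠ 0 := by exact_mod_cast hs
    have hz : Complex.exp (Complex.I * s) = E ^ 2 := by
      rw [hE, ← Complex.exp_nat_mul]; push_cast; ring_nf
    have h1 : E ^ 2 = 1 + 2 * Complex.I * Real.sin (s / 2) * E := by
      rw [ofReal_sin_half, ← hE]
      field_simp
      ring
    have h3 : ∀ m : ℕ, Complex.exp (Complex.I * (((m : ℝ) + 1 / 2) * s : ℝ)) = E ^ (2 * m + 1) :=
      fun m => by rw [hE, ← Complex.exp_nat_mul]; push_cast; ring_nf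
    rw [h3, h3, hz, div_add' _ _ _ hs', div_left_inj' hs']
    have h4 : E ^ (2 * (k + 1) + 1) = E ^ (2 * k + 1) * E ^ 2 := by ring
    have h5 : (E ^ 2) ^ (k + 1) = E ^ (2 * k + 1) * E := by ring
    rw [h4, h5]
    linear_combination E ^ (2 * k + 1) * h1

theorem cotKernel_zero_eq_cot_add_I {s : ℝ} (hs : Real.sin (s / 2) ≠ 0) :
    cotKernel 0 s = ((Real.cos (s / 2) / Real.sin (s / 2) : ℝ) : ℂ) + Complex.I := by
  have hs' : (Real.sin (s / 2) : ℂ) ≠ 0 := by exact_mod_cast hs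
  rw [cotKernel, show (((0 : ℕ) : ℝ) + 1 / 2) * s = s / 2 by push_cast; ring, mul_comm Complex.I,
    Complex.exp_mul_I]
  push_cast at hs' ⊢
  field_simp

/-- `Real.log` is `log |·|`, so one antiderivative serves on both sides of `θ`. -/
theorem hasDerivAt_two_mul_log_sin {θ t : ℝ} (hs : Real.sin ((t - θ) / 2) ≠ 0) :
    HasDerivAt (fun t : ℝ => ((2 * Real.log (Real.sin ((t - θ) / 2)) : ℝ) : ℂ) + Complex.I * t)
      (cotKernel 0 (t - θ)) t := by
  rw [cotKernel_zero_eq_cot_add_I hs]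
  refine HasDerivAt.add ?_ ?_
  · have h1 : HasDerivAt (fun t : ℝ => (t - θ) / 2) (1 / 2) t :=
      ((hasDerivAt_id t).sub_const θ).div_const 2
    have h2 := ((h1.sin).log hs).const_mul 2
    have h3 := h2.ofReal_comp
    refine h3.congr_deriv (congrArg _ ?_)
    ring
  · have h1 := (Complex.ofRealCLM.hasDerivAt (x := t)).const_mul Complex.I
    simpa using h1

theorem integral_cotKernel_zero {θ a b : ℝ} (hab : a ≤ b)
    (hs : ∀ t ∈ Set.Icc a b, Real.sin ((t - θ) / 2) ≠ 0) :
    ∫ t in a..b, cotKernel 0 (t - θ) =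
      ((2 * Real.log (Real.sin ((b - θ) / 2)) - 2 * Real.log (Real.sin ((a - θ) / 2)) : ℝ) : ℂ) +
        Complex.I * (b - a) := by
  rw [intervalIntegral.integral_eq_sub_of_hasDerivAt
    (f := fun t : ℝ => ((2 * Real.log (Real.sin ((t - θ) / 2)) : ℝ) : ℂ) + Complex.I * t)]
  · push_cast; ring
  · intro t ht
    rw [Set.uIcc_of_le hab] at ht
    exact hasDerivAt_two_mul_log_sin (hs t ht)
  · refine ContinuousOn.intervalIntegrable ?_
    rw [Set.uIcc_of_le hab]
    unfold cotKernel
    refine ContinuousOn.div (by fun_prop) (by fun_prop) fun t ht => ?_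
    exact_mod_cast hs t ht

theorem measurableSet_lt_abs_sub (θ ε : ℝ) : MeasurableSet {t : ℝ | ε < |t - θ|} :=
  measurableSet_lt measurable_const (by fun_prop)

theorem restrict_punctured (θ ε : ℝ) :
    volume.restrict {t | t ∈ Set.Icc (-Real.pi) Real.pi ∧ ε < |t - θ|} =
      arcMeasure.restrict {t | ε < |t - θ|} := by
  rw [arcMeasure, Measure.restrict_restrict (measurableSet_lt_abs_sub θ ε), Set.inter_comm]
  rfl

/-- The logarithms cancel: `|sin|` agrees at `θ ± ε` by symmetry, and equals `cos (θ/2)` at both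
ends `±π`. Only the constant part `i` of the kernel contributes. -/
theorem integral_punctured_cotKernel_zero {θ ε : ℝ} (hε : 0 < ε) (h1 : ε < Real.pi - θ)
    (h2 : ε < Real.pi + θ) (hθ : θ ∈ Set.Ioo (-Real.pi) Real.pi) :
    ∫ t in {t | ε < |t - θ|}, cotKernel 0 (t - θ) ∂arcMeasure =
      Complex.I * (2 * Real.pi - 2 * ε) := by
  obtain ⟨c, hc, hsin⟩ := exists_mul_abs_le_abs_sin hθ
  have hpi := Real.pi_pos
  have hne : ∀ t ∈ Set.Icc (-Real.pi) Real.pi, t ≠ θ → Real.sin ((t - θ) / 2) ≠ 0 :=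
    fun t ht hne h => by
      have := hsin t ht
      rw [h, abs_zero] at this
      have h3 : 0 < |t - θ| := abs_pos.2 (sub_ne_zero.2 hne)
      nlinarith
  have hset : {t | t ∈ Set.Icc (-Real.pi) Real.pi ∧ ε < |t - θ|} =
      Set.Ico (-Real.pi) (θ - ε) ∪ Set.Ioc (θ + ε) Real.pi := by
    ext t
    simp only [Set.mem_ofPred_eq, Set.mem_Icc, Set.mem_union, Set.mem_Ico, Set.mem_Ioc, lt_abs]
    constructor
    · rintro ⟨⟨h3, h4⟩, h5 | h5⟩
      · right; constructor <;> linarith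
      · left; constructor <;> linarith
    · rintro (⟨h3, h4⟩ | ⟨h3, h4⟩)
      · exact ⟨⟨h3, by linarith⟩, Or.inr (by linarith)⟩
      · exact ⟨⟨by linarith, h4⟩, Or.inl (by linarith)⟩
  have hint : ∀ a b : ℝ, -Real.pi ≤ a → b ≤ Real.pi → (b < θ ∨ θ < a) →
      ∀ t ∈ Set.Icc a b, Real.sin ((t - θ) / 2) ≠ 0 := fun a b ha hb h t ht => by
    refine hne t ⟨ha.trans ht.1, ht.2.trans hb⟩ ?_
    rintro rfl
    rcases h with h | h
    · exact absurd ht.2 (not_le.2 h)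
    · exact absurd ht.1 (not_le.2 h)
  have hi : ∀ a b : ℝ, (∀ t ∈ Set.Icc a b, Real.sin ((t - θ) / 2) ≠ 0) →
      IntegrableOn (fun t => cotKernel 0 (t - θ)) (Set.Icc a b) := fun a b h => by
    refine ContinuousOn.integrableOn_Icc ?_
    unfold cotKernel
    refine ContinuousOn.div (by fun_prop) (by fun_prop) fun t ht => ?_
    exact_mod_cast h t ht
  have ha := hint (-Real.pi) (θ - ε) le_rfl (by linarith) (Or.inl (by linarith))
  have hb := hint (θ + ε) Real.pi (by linarith) le_rfl (Or.inr (by linarith))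
  rw [← restrict_punctured, hset, setIntegral_union
    (Set.disjoint_left.2 fun t h3 h4 => by linarith [h3.2, h4.1]) measurableSet_Ioc
    ((hi _ _ ha).mono_set Set.Ico_subset_Icc_self) ((hi _ _ hb).mono_set Set.Ioc_subset_Icc_self),
    integral_Ico_eq_integral_Ioc, ← intervalIntegral.integral_of_le (by linarith),
    ← intervalIntegral.integral_of_le (by linarith), integral_cotKernel_zero (by linarith) ha,
    integral_cotKernel_zero (by linarith) hb]
  rw [show (θ - ε - θ) / 2 = -(ε / 2) by ring, show (θ + ε - θ) / 2 = ε / 2 by ring,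
    show (-Real.pi - θ) / 2 = -(θ / 2 + Real.pi / 2) by ring,
    show (Real.pi - θ) / 2 = Real.pi / 2 - θ / 2 by ring, Real.sin_neg, Real.sin_neg,
    Real.log_neg_eq_log, Real.log_neg_eq_log, Real.sin_add_pi_div_two, Real.sin_pi_div_two_sub]
  push_cast
  ring

/-! ### Principal values against functions with one-sided spectrum -/

theorem integral_annihilator_eq_zero {Φ : ℝ → ℂ} (hΦ : Integrable Φ arcMeasure)
    (hann : ∀ k : ℕ, k ≠ 0 → ∫ t : ℝ, Complex.exp (Complex.I * t) ^ k * Φ t ∂arcMeasure = 0)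
    {ρ : ℝ} (hρ : 0 ≤ ρ) (hρ1 : ρ < 1) (θ : ℝ) :
    ∫ t : ℝ, 2 * Complex.I * Complex.exp (Complex.I * (t - θ : ℝ)) /
      (1 - ρ * Complex.exp (Complex.I * (t - θ : ℝ))) * Φ t ∂arcMeasure = 0 := by
  have hi : Integrable (fun t : ℝ => 2 * Complex.I * Complex.exp (Complex.I * (t - θ : ℝ)) * Φ t)
      arcMeasure :=
    hΦ.bdd_mul (c := 2) (by fun_prop) (Eventually.of_forall fun t => by
      rw [norm_mul, norm_exp_I_mul]; simp)
  have h := hasSum_integral_geometric (a := (ρ : ℂ))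
    (ζ := fun t : ℝ => Complex.exp (Complex.I * (t - θ : ℝ))) hi (by fun_prop)
    (fun t => (norm_exp_I_mul _).le) (by rwa [Complex.norm_real, Real.norm_of_nonneg hρ])
  have h0 : ∀ j : ℕ, (ρ : ℂ) ^ j * ∫ t : ℝ, Complex.exp (Complex.I * (t - θ : ℝ)) ^ j *
      (2 * Complex.I * Complex.exp (Complex.I * (t - θ : ℝ)) * Φ t) ∂arcMeasure = 0 := fun j => by
    have h1 : ∀ t : ℝ, Complex.exp (Complex.I * (t - θ : ℝ)) ^ j *
        (2 * Complex.I * Complex.exp (Complex.I * (t - θ : ℝ)) * Φ t) =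
        2 * Complex.I * Complex.exp (-(Complex.I * θ)) ^ (j + 1) *
          (Complex.exp (Complex.I * t) ^ (j + 1) * Φ t) := fun t => by
      have h2 : Complex.exp (Complex.I * (t - θ : ℝ)) =
          Complex.exp (-(Complex.I * θ)) * Complex.exp (Complex.I * t) := by
        rw [← Complex.exp_add]; push_cast; ring_nf
      rw [h2, mul_pow]
      ring
    simp only [h1]
    rw [integral_const_mul, hann (j + 1) (Nat.succ_ne_zero j), mul_zero, mul_zero]
  simp only [h0] at h
  rw [← h.unique hasSum_zero]
  refine integral_congr_ae (Eventually.of_forall fun t => ?_)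
  simp only
  ring

theorem integrableOn_cotKernel_mul {Φ : ℝ → ℂ} (hΦ : Integrable Φ arcMeasure) {θ : ℝ}
    (hθ : θ ∈ Set.Ioo (-Real.pi) Real.pi) (k : ℕ) {ε : ℝ} (hε : 0 < ε) :
    IntegrableOn (fun t => cotKernel k (t - θ) * Φ t) {t | ε < |t - θ|} arcMeasure := by
  obtain ⟨c, hc, hsin⟩ := exists_mul_abs_le_abs_sin hθ
  refine Integrable.bdd_mul (c := (c * ε)⁻¹) hΦ.integrableOn
    ((measurable_cotKernel k).comp (by fun_prop)).aestronglyMeasurable ?_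
  filter_upwards [ae_restrict_mem (measurableSet_lt_abs_sub θ ε),
    ae_restrict_of_ae (ae_restrict_mem measurableSet_Icc)] with t ht ht'
  have ht2 : ε < |t - θ| := ht
  rw [norm_cotKernel]
  exact inv_anti₀ (by positivity) ((by gcongr : c * ε ≤ c * |t - θ|).trans (hsin t ht'))

theorem tendsto_punctured_integral {F : ℝ → ℂ} (hF : Integrable F arcMeasure) (θ : ℝ) :
    Tendsto (fun ε : ℝ => ∫ t in {t | ε < |t - θ|}, F t ∂arcMeasure) (𝓝[>] 0)
      (𝓝 (∫ t, F t ∂arcMeasure)) := by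
  simp only [← integral_indicator (measurableSet_lt_abs_sub θ _)]
  refine tendsto_integral_filter_of_dominated_convergence (fun t => ‖F t‖) ?_ ?_ hF.norm ?_
  · exact Eventually.of_forall fun ε => hF.1.indicator (measurableSet_lt_abs_sub θ ε)
  · exact Eventually.of_forall fun ε => Eventually.of_forall fun t => norm_indicator_le_norm_self _ _
  · have hne : ∀ᵐ t ∂arcMeasure, t ≠ θ := by
      refine ae_restrict_of_ae ?_
      simp [ae_iff]
    filter_upwards [hne] with t ht
    refine tendsto_const_nhds.congr' ?_
    filter_upwards [Ioo_mem_nhdsGT (abs_pos.2 (sub_ne_zero.2 ht))] with ε hε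
    rw [Set.indicator_of_mem]
    exact hε.2

/-- Over a common denominator the sum is `-2iεz² / ((1 - z)(1 - (1 - ε)z))`: the leading terms
cancel and leave a factor `ε`. -/
theorem norm_cotKernel_zero_add_le {s ε : ℝ} (hs : Real.sin (s / 2) ≠ 0) (hε : 0 ≤ ε)
    (hε1 : ε ≤ 1) :
    ‖cotKernel 0 s + 2 * Complex.I * Complex.exp (Complex.I * s) /
      (1 - (1 - ε : ℝ) * Complex.exp (Complex.I * s))‖ ≤ ε / Real.sin (s / 2) ^ 2 := by
  set z := Complex.exp (Complex.I * s) with hz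
  have hs0 : 0 < |Real.sin (s / 2)| := abs_pos.2 hs
  have h1 := norm_one_sub_exp_I_mul s
  have h2 := abs_sin_le_norm_one_sub_mul_exp hε hε1 s
  rw [← hz] at h1 h2
  have h3 : 1 - z ≠ 0 := by rw [← norm_pos_iff, h1]; positivity
  have h4 : 1 - (1 - ε : ℝ) * z ≠ 0 := by rw [← norm_pos_iff]; exact hs0.trans_le h2
  have h5 : cotKernel 0 s + 2 * Complex.I * z / (1 - (1 - ε : ℝ) * z) =
      -(2 * Complex.I * ε * z ^ 2) / ((1 - z) * (1 - (1 - ε : ℝ) * z)) := by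
    rw [cotKernel_zero hs, ← hz, div_add_div _ _ h3 h4]
    congr 1
    push_cast
    ring
  have hz1 : ‖z‖ = 1 := norm_exp_I_mul s
  rw [h5, norm_div, norm_neg, norm_mul, norm_mul, norm_mul, norm_mul, norm_pow, hz1, h1,
    Complex.norm_real, Real.norm_of_nonneg hε, Complex.norm_I, Complex.norm_ofNat, ← sq_abs (Real.sin _)]
  rw [div_le_div_iff₀ (by positivity) (by positivity)]
  nlinarith [mul_le_mul_of_nonneg_left h2 (mul_nonneg hε hs0.le)]

theorem tendsto_principalValue_cotKernel_zero {Φ : ℝ → ℂ} (hΦ : Integrable Φ arcMeasure)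
    (hann : ∀ k : ℕ, k ≠ 0 → ∫ t : ℝ, Complex.exp (Complex.I * t) ^ k * Φ t ∂arcMeasure = 0)
    {θ : ℝ} (hθ : θ ∈ Set.Ioo (-Real.pi) Real.pi) (hL : IsLebesguePoint Φ θ) :
    Tendsto (fun ε : ℝ => ∫ t in {t | ε < |t - θ|}, cotKernel 0 (t - θ) * Φ t ∂arcMeasure)
      (𝓝[>] 0) (𝓝 (2 * Real.pi * Complex.I * Φ θ)) := by
  obtain ⟨c, hc, hsin⟩ := exists_mul_abs_le_abs_sin hθ
  set A : ℝ → ℝ → ℂ := fun ε t => 2 * Complex.I * Complex.exp (Complex.I * (t - θ : ℝ)) /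
      (1 - (1 - ε : ℝ) * Complex.exp (Complex.I * (t - θ : ℝ))) with hA
  -- The truncation radius and the distance `1 - ρ` to the circle are the same `ε`. Beyond `ε` the
  -- two kernels nearly cancel, giving decay `ε / (t - θ)²`; within `ε` only `A` remains, of size at
  -- most `2 / ε`.
  set M : ℝ → ℝ → ℂ := fun ε t =>
    {t : ℝ | ε < |t - θ|}.indicator (fun t => cotKernel 0 (t - θ)) t + A ε t with hM
  have hΨ : Integrable (fun t => Φ t - Φ θ) arcMeasure := hΦ.sub (integrable_const _)
  have hAbd : ∀ ε, 0 < ε → ε ≤ 1 → ∀ t, ‖A ε t‖ ≤ 2 / ε := fun ε hε hε1 t => by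
    rw [hA, norm_div, norm_mul, norm_exp_I_mul, norm_mul, Complex.norm_I, Complex.norm_ofNat,
      mul_one, mul_one]
    gcongr
    exact le_norm_one_sub_mul_exp hε1 _
  have hbd : ∀ ε, 0 < ε → ε ≤ 1 → ∀ t ∈ Set.Icc (-Real.pi) Real.pi,
      ‖M ε t‖ ≤ (2 + 1 / c ^ 2) / ε ∧ ‖M ε t‖ * (t - θ) ^ 2 ≤ (2 + 1 / c ^ 2) * ε := by
    intro ε hε hε1 t ht
    have hc2 : 0 < 1 / c ^ 2 := by positivity
    rcases lt_or_ge ε |t - θ| with h | h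
    · have hΔ : 0 < |t - θ| := hε.trans h
      have h1 := hsin t ht
      have h2 : 0 < |Real.sin ((t - θ) / 2)| := (by positivity : 0 < c * |t - θ|).trans_le h1
      have h3 : ‖M ε t‖ ≤ ε / Real.sin ((t - θ) / 2) ^ 2 := by
        rw [hM]
        simp only
        rw [Set.indicator_of_mem (by exact h)]
        exact norm_cotKernel_zero_add_le (abs_pos.1 h2) hε.le hε1
      have h4 : c ^ 2 * (t - θ) ^ 2 ≤ Real.sin ((t - θ) / 2) ^ 2 := by
        rw [← sq_abs (t - θ), ← sq_abs (Real.sin _), ← mul_pow]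
        gcongr
      have hΔ2 : 0 < (t - θ) ^ 2 := by rw [← sq_abs]; positivity
      have h5 : ‖M ε t‖ ≤ ε / (c ^ 2 * (t - θ) ^ 2) := h3.trans (by gcongr)
      have h6 : ‖M ε t‖ * (t - θ) ^ 2 ≤ 1 / c ^ 2 * ε := by
        calc _ ≤ ε / (c ^ 2 * (t - θ) ^ 2) * (t - θ) ^ 2 := by gcongr
          _ = _ := by field_simp [(abs_pos.1 hΔ)]
      have h7 : ε ^ 2 ≤ (t - θ) ^ 2 := by rw [← sq_abs (t - θ)]; gcongr
      refine ⟨?_, h6.trans (by gcongr; linarith)⟩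
      calc ‖M ε t‖ ≤ ε / (c ^ 2 * ε ^ 2) := h5.trans (by gcongr)
        _ = (1 / c ^ 2) / ε := by field_simp
        _ ≤ _ := by gcongr; linarith
    · have h3 : ‖M ε t‖ ≤ 2 / ε := by
        rw [hM]
        simp only
        rw [Set.indicator_of_notMem (by simpa using h), zero_add]
        exact hAbd ε hε hε1 t
      have h7 : (t - θ) ^ 2 ≤ ε ^ 2 := by rw [← sq_abs (t - θ)]; gcongr
      refine ⟨h3.trans (by gcongr; linarith), ?_⟩
      calc _ ≤ 2 / ε * ε ^ 2 := by gcongr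
        _ = 2 * ε := by field_simp
        _ ≤ _ := by gcongr; linarith
  have hlim : Tendsto (fun ε => ∫ t, M ε t * (Φ t - Φ θ) ∂arcMeasure) (𝓝[>] 0) (𝓝 0) := by
    refine tendsto_integral_kernel_mul hΨ (C := 2 + 1 / c ^ 2) hL (by positivity) ?_ ?_
    · filter_upwards [Ioc_mem_nhdsGT (zero_lt_one' ℝ)] with ε hε
      filter_upwards [ae_restrict_mem measurableSet_Icc] with t ht
        using (hbd ε hε.1 hε.2 t ht).1
    · filter_upwards [Ioc_mem_nhdsGT (zero_lt_one' ℝ)] with ε hε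
      filter_upwards [ae_restrict_mem measurableSet_Icc] with t ht
        using (hbd ε hε.1 hε.2 t ht).2
  have hconst : Tendsto (fun ε : ℝ => Complex.I * (2 * Real.pi - 2 * ε) * Φ θ) (𝓝[>] 0)
      (𝓝 (Complex.I * (2 * Real.pi - 2 * (0 : ℝ)) * Φ θ)) :=
    (Continuous.tendsto (by fun_prop) 0).mono_left nhdsWithin_le_nhds
  have h1 := hlim.add hconst
  rw [zero_add, show Complex.I * (2 * Real.pi - 2 * ((0 : ℝ) : ℂ)) * Φ θ =
    2 * Real.pi * Complex.I * Φ θ by push_cast; ring] at h1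
  refine h1.congr' ?_
  have e1 : 0 < Real.pi - θ := by linarith [hθ.2]
  have e2 : 0 < Real.pi + θ := by linarith [hθ.1]
  filter_upwards [Ioo_mem_nhdsGT (zero_lt_one' ℝ), Ioo_mem_nhdsGT e1, Ioo_mem_nhdsGT e2]
    with ε hε hε1 hε2
  have hAi : ∀ Ψ : ℝ → ℂ, Integrable Ψ arcMeasure →
      Integrable (fun t => A ε t * Ψ t) arcMeasure := fun Ψ hΨ =>
    hΨ.bdd_mul (Measurable.aestronglyMeasurable (by fun_prop))
      (Eventually.of_forall fun t => hAbd ε hε.1 hε.2.le t)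
  have hA0 : ∀ Ψ : ℝ → ℂ, Integrable Ψ arcMeasure →
      (∀ k : ℕ, k ≠ 0 → ∫ t : ℝ, Complex.exp (Complex.I * t) ^ k * Ψ t ∂arcMeasure = 0) →
      ∫ t, A ε t * Ψ t ∂arcMeasure = 0 := fun Ψ hΨ h =>
    integral_annihilator_eq_zero hΨ h (by linarith [hε.2]) (by linarith [hε.1]) θ
  -- Constants are also annihilated by `e^{ikt}` for `k ≥ 1`, so subtracting `Φ θ` preserves the
  -- annihilation.
  have hA2 : ∫ t, A ε t * (Φ t - Φ θ) ∂arcMeasure = 0 := by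
    refine hA0 _ hΨ fun k hk => ?_
    have hek : ∀ Ψ : ℝ → ℂ, Integrable Ψ arcMeasure →
        Integrable (fun t : ℝ => Complex.exp (Complex.I * t) ^ k * Ψ t) arcMeasure := fun Ψ hΨ =>
      hΨ.bdd_mul (c := 1) (by fun_prop) (Eventually.of_forall fun t => by
        rw [norm_pow, norm_exp_I_mul, one_pow])
    simp only [mul_sub]
    rw [integral_sub (hek _ hΦ) (hek _ (integrable_const _)), hann k hk, integral_mul_const,
      integral_exp_I_mul_pow hk, zero_mul, sub_zero]
  have hKi := integrableOn_cotKernel_mul hΨ hθ 0 hε.1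
  have hK1 := integrableOn_cotKernel_mul (integrable_const (Φ θ)) hθ 0 hε.1
  have hsplit : ∫ t, M ε t * (Φ t - Φ θ) ∂arcMeasure =
      ∫ t in {t | ε < |t - θ|}, cotKernel 0 (t - θ) * (Φ t - Φ θ) ∂arcMeasure := by
    have h2 : ∀ t, M ε t * (Φ t - Φ θ) =
        {t : ℝ | ε < |t - θ|}.indicator (fun t => cotKernel 0 (t - θ) * (Φ t - Φ θ)) t +
          A ε t * (Φ t - Φ θ) := fun t => by
      simp only [hM, add_mul, Set.indicator_mul_left]
    simp only [h2]
    rw [integral_add ((integrable_indicator_iff (measurableSet_lt_abs_sub θ ε)).2 hKi)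
      (hAi _ hΨ), hA2, add_zero, integral_indicator (measurableSet_lt_abs_sub θ ε)]
  rw [hsplit, ← integral_punctured_cotKernel_zero hε.1 hε1.2 hε2.2 hθ, ← integral_mul_const,
    ← integral_add hKi hK1]
  refine integral_congr_ae (Eventually.of_forall fun t => ?_)
  simp only
  ring

theorem tendsto_principalValue_cotKernel {Φ : ℝ → ℂ} (hΦ : Integrable Φ arcMeasure)
    (hann : ∀ k : ℕ, k ≠ 0 → ∫ t : ℝ, Complex.exp (Complex.I * t) ^ k * Φ t ∂arcMeasure = 0)
    {θ : ℝ} (hθ : θ ∈ Set.Ioo (-Real.pi) Real.pi) (hL : IsLebesguePoint Φ θ) (k : ℕ) :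
    Tendsto (fun ε : ℝ => ∫ t in {t | ε < |t - θ|}, cotKernel k (t - θ) * Φ t ∂arcMeasure)
      (𝓝[>] 0) (𝓝 (2 * Real.pi * Complex.I * Φ θ)) := by
  obtain ⟨c, hc, hsin⟩ := exists_mul_abs_le_abs_sin hθ
  -- The difference between the kernels for `k` and for `0`, times `Φ`: it is integrable with
  -- integral zero, so it does not change the principal value.
  set D : ℝ → ℂ := fun t =>
    ∑ j ∈ Finset.range k, 2 * Complex.I * Complex.exp (Complex.I * (t - θ : ℝ)) ^ (j + 1) * Φ t
    with hD
  have hDi : ∀ j ∈ Finset.range k, Integrable (fun t : ℝ =>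
      2 * Complex.I * Complex.exp (Complex.I * (t - θ : ℝ)) ^ (j + 1) * Φ t) arcMeasure :=
    fun j _ => hΦ.bdd_mul (c := 2) (by fun_prop) (Eventually.of_forall fun t => by
      rw [norm_mul, norm_pow, norm_exp_I_mul]; simp)
  have hDI : Integrable D arcMeasure := integrable_finsetSum _ hDi
  have hD0 : ∫ t, D t ∂arcMeasure = 0 := by
    rw [integral_finsetSum _ hDi]
    refine Finset.sum_eq_zero fun j _ => ?_
    have h1 : ∀ t : ℝ, 2 * Complex.I * Complex.exp (Complex.I * (t - θ : ℝ)) ^ (j + 1) * Φ t =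
        2 * Complex.I * Complex.exp (-(Complex.I * θ)) ^ (j + 1) *
          (Complex.exp (Complex.I * t) ^ (j + 1) * Φ t) := fun t => by
      have h2 : Complex.exp (Complex.I * (t - θ : ℝ)) =
          Complex.exp (-(Complex.I * θ)) * Complex.exp (Complex.I * t) := by
        rw [← Complex.exp_add]; push_cast; ring_nf
      rw [h2, mul_pow]
      ring
    simp only [h1]
    rw [integral_const_mul, hann _ (Nat.succ_ne_zero j), mul_zero]
  have h := (tendsto_principalValue_cotKernel_zero hΦ hann hθ hL).add
    (tendsto_punctured_integral hDI θ)
  rw [hD0, add_zero] at h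
  refine h.congr' ?_
  filter_upwards [self_mem_nhdsWithin] with ε hε
  have hε0 : (0 : ℝ) < ε := hε
  rw [← integral_add (integrableOn_cotKernel_mul hΦ hθ 0 hε0) hDI.integrableOn]
  refine integral_congr_ae ?_
  filter_upwards [ae_restrict_mem (measurableSet_lt_abs_sub θ ε),
    ae_restrict_of_ae (ae_restrict_mem measurableSet_Icc)] with t ht ht'
  have ht2 : ε < |t - θ| := ht
  have hs : Real.sin ((t - θ) / 2) ≠ 0 := by
    have h1 := hsin t ht'
    have h2 : 0 < |t - θ| := hε0.trans ht2
    exact abs_pos.1 ((by positivity : 0 < c * |t - θ|).trans_le h1)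
  rw [cotKernel_eq hs k, add_mul, Finset.sum_mul]

/-! ### Return to the real conjugate pair -/

theorem hasPrincipalValue_of_tendsto {h : ℝ → ℝ} {θ I : ℝ}
    (hi : ∀ ε, 0 < ε → IntegrableOn h {t | ε < |t - θ|} arcMeasure)
    (hlim : Tendsto (fun ε : ℝ => ∫ t in {t | ε < |t - θ|}, h t ∂arcMeasure) (𝓝[>] 0) (𝓝 I)) :
    HasPrincipalValue h θ I := by
  unfold HasPrincipalValue IntegrableOn
  simp only [restrict_punctured]
  exact ⟨hi, hlim⟩

theorem ae_mem_Ioo_arcMeasure : ∀ᵐ θ ∂arcMeasure, θ ∈ Set.Ioo (-Real.pi) Real.pi := by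
  rw [arcMeasure, ← restrict_Ioo_eq_restrict_Icc]
  exact ae_restrict_mem measurableSet_Ioo

/-- The nonpositive Fourier coefficients of `f + i g` vanish when `g` is conjugate to `f`. -/
theorem integral_exp_mul_conjugate_eq_zero {f g : ℝ → ℝ} (hf : Integrable f arcMeasure)
    (hf0 : ∫ θ, f θ ∂arcMeasure = 0) (hg : Integrable g arcMeasure)
    (hfg : IsFourierConjugate f g) (k : ℕ) :
    ∫ t : ℝ, Complex.exp (Complex.I * t) ^ k * ((f t : ℂ) + Complex.I * g t) ∂arcMeasure = 0 := by
  -- The positive and negative parts have Poisson integrals that are nonnegative, as the Smirnov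
  -- argument requires.
  have hp : Integrable (fun t => max (f t) 0) arcMeasure := hf.pos_part
  have hq : Integrable (fun t => max (-f t) 0) arcMeasure := hf.neg_part
  have hpq : (fun t => max (f t) 0 - max (-f t) 0) = f :=
    funext fun t => max_zero_sub_max_neg_zero_eq_self (f t)
  have hsub : ∀ z : ℂ, ‖z‖ < 1 → innerAnalytic f z =
      innerAnalytic (fun t => max (f t) 0) z - innerAnalytic (fun t => max (-f t) 0) z :=
    fun z hz => by rw [← innerAnalytic_sub hp hq hz, hpq]
  have hzero : innerAnalytic f 0 = 0 := by
    rw [innerAnalytic, tsum_eq_single 0 (fun k hk => by simp [hk])]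
    simp [taylorCoeff, cosCoeff, intervalIntegral_eq_integral_arcMeasure, hf0]
  refine integral_exp_mul_radialLimit_eq_zero (differentiableOn_innerAnalytic hp)
    (differentiableOn_innerAnalytic hq)
    (fun z hz => re_innerAnalytic_nonneg hp (fun t => le_max_right _ _) (by simpa using hz))
    (fun z hz => re_innerAnalytic_nonneg hq (fun t => le_max_right _ _) (by simpa using hz))
    ?_ ((integrable_ofReal hf).add ((integrable_ofReal hg).const_mul _)) ?_ k
  · have h := hsub 0 (by simp)
    rw [hzero] at h
    exact (sub_eq_zero.1 h.symm)
  · filter_upwards [ae_isLebesguePoint (integrable_ofReal hf), hfg, ae_mem_Ioo_arcMeasure]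
      with θ hL him hθ
    have hre := tendsto_re_innerAnalytic hf hθ hL
    have h1 : Tendsto (fun ρ : ℝ =>
        ((innerAnalytic f (ρ * Complex.exp (Complex.I * (θ : ℂ)))).re : ℂ) +
          Complex.I * ((innerAnalytic f (ρ * Complex.exp (Complex.I * (θ : ℂ)))).im : ℂ))
        (𝓝[<] 1) (𝓝 ((f θ : ℂ) + Complex.I * g θ)) :=
      ((Complex.continuous_ofReal.tendsto _).comp hre).add
        (((Complex.continuous_ofReal.tendsto _).comp him).const_mul _)
    refine h1.congr' ?_
    filter_upwards [Ioo_mem_nhdsLT (zero_lt_one' ℝ)] with ρ hρ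
    rw [← hsub _ (by rw [norm_ofReal_mul_exp hρ.1.le]; exact hρ.2)]
    exact (congrArg _ (mul_comm _ _)).trans (Complex.re_add_im _)

theorem cotKernel_mul_re_im (k : ℕ) (s a b : ℝ) :
    (cotKernel k s * ((a : ℂ) + Complex.I * b)).im =
      (Real.sin (((k : ℝ) + 1 / 2) * s) * a + Real.cos (((k : ℝ) + 1 / 2) * s) * b) /
        Real.sin (s / 2) ∧
    -(cotKernel k s * ((a : ℂ) + Complex.I * b)).re =
      (Real.sin (((k : ℝ) + 1 / 2) * s) * b - Real.cos (((k : ℝ) + 1 / 2) * s) * a) /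
        Real.sin (s / 2) := by
  have h : cotKernel k s * ((a : ℂ) + Complex.I * b) =
      ((-(Real.sin (((k : ℝ) + 1 / 2) * s) * b - Real.cos (((k : ℝ) + 1 / 2) * s) * a) /
        Real.sin (s / 2) : ℝ) : ℂ) +
      ((Real.sin (((k : ℝ) + 1 / 2) * s) * a + Real.cos (((k : ℝ) + 1 / 2) * s) * b) /
        Real.sin (s / 2) : ℝ) * Complex.I := by
    have := Complex.I_mul_I
    rw [cotKernel, mul_comm Complex.I, Complex.exp_mul_I, ← Complex.ofReal_cos,
      ← Complex.ofReal_sin, Complex.ofReal_div, Complex.ofReal_div]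
    simp only [Complex.ofReal_neg, Complex.ofReal_sub, Complex.ofReal_add, Complex.ofReal_mul,
      div_eq_mul_inv]
    generalize Real.sin (((k : ℝ) + 1 * 2⁻¹) * s) = x, Real.cos (((k : ℝ) + 1 * 2⁻¹) * s) = y,
      Real.sin (s * 2⁻¹) = d
    linear_combination ((x : ℂ) * b * (d : ℂ)⁻¹) * this
  rw [h]
  constructor
  · rw [Complex.add_im, Complex.ofReal_im, Complex.im_ofReal_mul, Complex.I_im, mul_one, zero_add]
  · rw [Complex.add_re, Complex.ofReal_re, Complex.re_ofReal_mul, Complex.I_re, mul_zero, add_zero,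
      neg_div, neg_neg]

theorem theorem4 (f g : ℝ → ℝ)
    (hf : IntegrableOn f (Set.Icc (-Real.pi) Real.pi) volume)
    (hf0 : ∫ θ in (-Real.pi)..Real.pi, f θ = 0)
    (hg : IntegrableOn g (Set.Icc (-Real.pi) Real.pi) volume)
    (hfg : IsFourierConjugate f g) :
    ∀ᵐ θ : ℝ ∂(volume.restrict (Set.Icc (-Real.pi) Real.pi)), ∀ k : ℕ, 1 ≤ k →
      (∃ I : ℝ,
        HasPrincipalValue
          (fun θ₁ => (Real.sin (((k : ℝ) + 1 / 2) * (θ₁ - θ)) * f θ₁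
              + Real.cos (((k : ℝ) + 1 / 2) * (θ₁ - θ)) * g θ₁) / Real.sin ((θ₁ - θ) / 2)) θ I ∧
        f θ = 1 / (2 * Real.pi) * I) ∧
      (∃ I : ℝ,
        HasPrincipalValue
          (fun θ₁ => (Real.sin (((k : ℝ) + 1 / 2) * (θ₁ - θ)) * g θ₁
              - Real.cos (((k : ℝ) + 1 / 2) * (θ₁ - θ)) * f θ₁) / Real.sin ((θ₁ - θ) / 2)) θ I ∧
        g θ = 1 / (2 * Real.pi) * I) := by
  set Φ : ℝ → ℂ := fun t => (f t : ℂ) + Complex.I * g t with hΦdef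
  have hΦ : Integrable Φ arcMeasure :=
    (integrable_ofReal hf).add ((integrable_ofReal hg).const_mul _)
  rw [intervalIntegral_eq_integral_arcMeasure] at hf0
  have hann : ∀ k : ℕ, k ≠ 0 →
      ∫ t : ℝ, Complex.exp (Complex.I * t) ^ k * Φ t ∂arcMeasure = 0 := fun k _ =>
    integral_exp_mul_conjugate_eq_zero hf hf0 hg hfg k
  -- The exceptional set consists of non-Lebesgue points and the endpoints `±π`; it does not depend
  -- on `k`, so a single null set serves all `k`.
  filter_upwards [ae_isLebesguePoint hΦ, ae_mem_Ioo_arcMeasure] with θ hL hθ k _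
  have hlim := tendsto_principalValue_cotKernel hΦ hann hθ hL k
  have hint : ∀ ε, 0 < ε → IntegrableOn (fun t => cotKernel k (t - θ) * Φ t)
      {t | ε < |t - θ|} arcMeasure := fun ε hε => integrableOn_cotKernel_mul hΦ hθ k hε
  have hval : 2 * Real.pi * Complex.I * Φ θ =
      ((-(2 * Real.pi * g θ) : ℝ) : ℂ) + ((2 * Real.pi * f θ : ℝ) : ℂ) * Complex.I := by
    simp only [hΦdef]
    push_cast
    linear_combination (2 * Real.pi * g θ : ℂ) * Complex.I_mul_I
  rw [hval] at hlim
  have hpi := Real.pi_pos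
  constructor
  · refine ⟨2 * Real.pi * f θ, ?_, by field_simp⟩
    simp only [← (cotKernel_mul_re_im _ _ _ _).1]
    refine hasPrincipalValue_of_tendsto (fun ε hε => (hint ε hε).im) ?_
    have h := (Complex.continuous_im.tendsto _).comp hlim
    rw [Complex.add_im, Complex.ofReal_im, Complex.im_ofReal_mul, Complex.I_im, mul_one,
      zero_add] at h
    refine h.congr' ?_
    filter_upwards [self_mem_nhdsWithin] with ε hε
    exact (integral_im (hint ε hε)).symm
  · refine ⟨2 * Real.pi * g θ, ?_, by field_simp⟩
    simp only [← (cotKernel_mul_re_im _ _ _ _).2]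
    refine hasPrincipalValue_of_tendsto (fun ε hε => (hint ε hε).re.neg) ?_
    have h := ((Complex.continuous_re.tendsto _).comp hlim).neg
    rw [Complex.add_re, Complex.ofReal_re, Complex.re_ofReal_mul, Complex.I_re, mul_zero,
      add_zero, neg_neg] at h
    refine h.congr' ?_
    filter_upwards [self_mem_nhdsWithin] with ε hε
    rw [integral_neg]
    exact congrArg Neg.neg (integral_re (hint ε hε)).symm
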